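/- A \emph{pawn game} with $d$ pawns consists of a finite set of vertices $V = V_1 \cup \dots \cup V_d$, where $V_j$ is the set of vertices owned by pawn $j$, a set of directed edges $E \subseteq V \times V$, and a target set $T \subseteq V$. It is \emph{MVPP} (multiple vertices per pawn) if each vertex is owned by exactly one pawn. A configuration $\langle v, P\rangle$ consists of the vertex $v$ that holds the token and the set $P \subseteq [d]$ of pawns controlled by Player 1; Player 2 controls the pawns in $[d] \setminus P$. At $\langle v, P\rangle$ the token is moved along an edge from $v$ to some $v'$, by Player 1 if he controls a pawn that owns $v$ and by Player 2 otherwise. Under the \emph{always-grab-or-give} mechanism, the player who did not move must then either grab one pawn of the player who moved or give one of her own pawns to that player: she chooses $j \in [d]$, and the game proceeds to $\langle v', P \setminus \{j\}\rangle$ if $j \in P$, and to $\langle v', P \cup \{j\}\rangle$ if $j \notin P$. Player 1 wins a play iff it reaches a configuration $\langle v, P\rangle$ with $v \in T$. He wins from a configuration $c$ if, in the turn-based game on configurations and intermediate positions (the choice of $j$) so described, he has a memoryless strategy that wins from $c$ against every memoryless strategy of Player 2. A play that gets stuck at a vertex without outgoing edges ends there. \textbf{Theorem.} The following decision problem (MVPP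 always-grab-or-give PAWN-GAMES) is in PTIME: given an MVPP pawn game $\mathcal G$ and an initial configuration $c$ (encoded as a binary word by listing the number of vertices, the number of pawns and the initial vertex in unary, the ownership and adjacency matrices, the target set and the initial set of pawns of Player 1), decide whether Player 1 wins from $c$ in $\mathcal G$ under the always-grab-or-give mechanism. That is, the language of the encodings of all pairs $(\mathcal G, c)$ such that $\mathcal G$ is MVPP and Player 1 wins from $c$ is decided by a Turing machine in time polynomial in the length of the input word. -/

import Mathlib

namespace PawnGames

/-! ### Turn-based reachability games -/

/-- The two players. -/
inductive Player
  | one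
  | two

/-- The other player. -/
def Player.opponent : Player → Player
  | .one => .two
  | .two => .one

/-- A turn-based reachability game on the vertex set `V`: every vertex belongs to one of the two
players, `edge` is the set of directed edges, and `target` is the set that Player 1 wants to reach
and Player 2 wants to avoid. -/
structure TurnBasedGame (V : Type) where
  owner : V → Player
  edge : V → V → Prop
  target : Set V

namespace TurnBasedGame

variable {V : Type} (G : TurnBasedGame V)

/-- `f` is a (memoryless) strategy of Player `i`: at each vertex of Player `i` that has a neighbour
at all, it prescribes a neighbour. The values of `f` at other vertices are never used. -/
def IsStrategy (i : Player) (f : V → V) : Prop :=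
  ∀ v, G.owner v = i → (∃ u, G.edge v u) → G.edge v (f v)

open Classical in
/-- The vertex that follows `v` when the players use `f₁` and `f₂`; there is none if `v` has no
neighbours. -/
noncomputable def next (f₁ f₂ : V → V) (v : V) : Option V :=
  if ∃ u, G.edge v u then
    some (match G.owner v with
      | .one => f₁ v
      | .two => f₂ v)
  else none

/-- The unique play from `v₀` under `f₁` and `f₂`. It is an infinite path, or a finite path that
stops in a vertex without neighbours (after which the value is `none`). -/
noncomputable def play (f₁ f₂ : V → V) (v₀ : V) : ℕ → Option V
  | 0 => some v₀
  | k + 1 => (play f₁ f₂ v₀ k).bind (G.next f₁ f₂)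

/-- Player 1 wins from `v₀`: he has a strategy such that, against every strategy of Player 2, the
resulting play reaches the target. -/
def PlayerOneWins (v₀ : V) : Prop :=
  ∃ f₁, G.IsStrategy .one f₁ ∧
    ∀ f₂, G.IsStrategy .two f₂ → ∃ k, ∃ t ∈ G.target, G.play f₁ f₂ v₀ k = some t

end TurnBasedGame

/-! ### Pawn games -/

/-- A pawn game (without its mechanism) with `n` vertices and `d` pawns. `owned j` is the set of
vertices that pawn `j` owns; together these sets cover all vertices (they may overlap). -/
structure PawnGame (n d : ℕ) where
  owned : Fin d → Finset (Fin n)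
  edges : Finset (Fin n × Fin n)
  target : Finset (Fin n)
  owned_cover : ∀ v, ∃ j, v ∈ owned j

namespace PawnGame

variable {n d : ℕ} (G : PawnGame n d)

/-- Multiple vertices per pawn: each vertex is owned by exactly one pawn. -/
def IsMVPP : Prop :=
  ∀ v, ∃! j, v ∈ G.owned j

/-- The set `N(v)` of neighbours of `v`. -/
def neighbors (v : Fin n) : Finset (Fin n) :=
  Finset.univ.filter fun u => (v, u) ∈ G.edges

end PawnGame

/-- A configuration: the vertex that holds the token, and the set of pawns that Player 1 controls
(Player 2 controls all other pawns). -/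
structure Config (n d : ℕ) where
  vertex : Fin n
  pawns : Finset (Fin d)

namespace PawnGame

variable {n d : ℕ} (G : PawnGame n d)

open Classical in
/-- The player who moves the token: Player 1 iff he controls a pawn that owns the token's vertex. -/
noncomputable def mover (c : Config n d) : Player :=
  if ∃ j ∈ c.pawns, c.vertex ∈ G.owned j then .one else .two

/-- The turn-based game that gives the semantics of the always-grab-or-give mechanism. Its vertices
are the configurations `c` and the intermediate vertices `(v', c)`, reached when the token has been
moved from `c` to `v'`. There the player who did not move has to grab a pawn from, or give a pawn to,
the player who moved, so that exactly one pawn changes hands: either a pawn `j` of Player 1 goes to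
Player 2, or a pawn `j` of Player 2 goes to Player 1. -/
noncomputable def alwaysGrabOrGive : TurnBasedGame (Config n d ⊕ Fin n × Config n d) where
  owner
    | .inl c => G.mover c
    | .inr (_, c) => (G.mover c).opponent
  edge
    | .inl c, .inr (v', c') => v' ∈ G.neighbors c.vertex ∧ c' = c
    | .inr (v', c), .inl c' =>
        (∃ j ∈ c.pawns, c' = ⟨v', c.pawns.erase j⟩) ∨
          (∃ j, j ∉ c.pawns ∧ c' = ⟨v', insert j c.pawns⟩)
    | _, _ => False
  target := {x | ∃ c : Config n d, x = .inl c ∧ c.vertex ∈ G.target}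

end PawnGame

/-! ### The decision problem -/

/-- The block `1…10` with `k` ones. -/
def unary (k : ℕ) : List Bool :=
  List.replicate k true ++ [false]

/-- The characteristic bit vector of a subset of `{0, …, m - 1}`. -/
def bits {m : ℕ} (S : Finset (Fin m)) : List Bool :=
  List.ofFn fun i => decide (i ∈ S)

/-- The binary encoding of a pawn game with an initial configuration: the numbers of vertices and
pawns and the initial vertex (in unary), the ownership matrix, the adjacency matrix, the target set,
and the set of pawns that Player 1 controls initially. -/
def encode {n d : ℕ} (G : PawnGame n d) (c : Config n d) : List Bool :=
  unary n ++ unary d ++ unary c.vertex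
    ++ (List.ofFn fun j => bits (G.owned j)).flatten
    ++ (List.ofFn fun v => bits (G.neighbors v)).flatten
    ++ bits G.target ++ bits c.pawns

theorem unary_append_inj {k l : ℕ} {r s : List Bool} (h : unary k ++ r = unary l ++ s) :
    k = l ∧ r = s := by
  induction k generalizing l with
  | zero => cases l <;> simp_all [unary, List.replicate_succ]
  | succ k ih =>
    cases l with
    | zero => simp [unary, List.replicate_succ] at h
    | succ l =>
      have := @ih l (by simpa [unary, List.replicate_succ] using h)
      exact ⟨by rw [this.1], this.2⟩

theorem bits_injective {m : ℕ} : Function.Injective (bits (m := m)) := by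
  intro S T h
  have h' := List.ofFn_injective h
  ext i
  simpa using congrFun h' i

theorem bits_rows_injective {k m : ℕ} {F F' : Fin k → Finset (Fin m)} {r s : List Bool}
    (h : (List.ofFn fun j => bits (F j)).flatten ++ r = (List.ofFn fun j => bits (F' j)).flatten ++ s) :
    F = F' ∧ r = s := by
  induction k with
  | zero => exact ⟨Subsingleton.elim _ _, by simpa using h⟩
  | succ k ih =>
    rw [List.ofFn_succ, List.ofFn_succ, List.flatten_cons, List.flatten_cons, List.append_assoc,
      List.append_assoc] at h
    obtain ⟨h0, h1⟩ := List.append_inj h (by simp [bits])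
    obtain ⟨h2, h3⟩ := ih h1
    refine ⟨?_, h3⟩
    funext j
    refine Fin.cases (bits_injective h0) (fun i => congrFun h2 i) j

/-- Different inputs have different encodings. -/
theorem encode_injective {n d n' d' : ℕ} {G : PawnGame n d} {c : Config n d} {G' : PawnGame n' d'}
    {c' : Config n' d'} (h : encode G c = encode G' c') :
    n = n' ∧ d = d' ∧ HEq G G' ∧ HEq c c' := by
  simp only [encode, List.append_assoc] at h
  obtain ⟨rfl, h⟩ := unary_append_inj h
  obtain ⟨rfl, h⟩ := unary_append_inj h
  obtain ⟨h1, h⟩ := unary_append_inj h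
  obtain ⟨h2, h⟩ := bits_rows_injective h
  obtain ⟨h3, h⟩ := bits_rows_injective h
  obtain ⟨h4, h5⟩ := List.append_inj h (by simp [bits])
  refine ⟨rfl, rfl, heq_of_eq ?_, heq_of_eq ?_⟩
  · cases G
    cases G'
    simp only [PawnGame.mk.injEq]
    refine ⟨funext fun j => congrFun h2 j, ?_, bits_injective h4⟩
    ext ⟨v, u⟩
    have := congrArg (fun S => u ∈ S) (congrFun h3 v)
    simpa [PawnGame.neighbors] using this
  · cases c
    cases c'
    simp only [Config.mk.injEq]
    exact ⟨Fin.ext h1, bits_injective h5⟩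

/-- The problem MVPP always-grab-or-give PAWN-GAMES, as a language: the encodings of an MVPP pawn
game with an initial configuration from which Player 1 wins under always grabbing or giving. -/
def mvppAlwaysGrabOrGivePawnGames : Language Bool :=
  {w | ∃ (n d : ℕ) (G : PawnGame n d) (c : Config n d),
    w = encode G c ∧ G.IsMVPP ∧ G.alwaysGrabOrGive.PlayerOneWins (.inl c)}

open Classical in
/-- The class PTIME: a language is in it iff some multi-stack (equivalently, multi-tape) Turing
machine computes its characteristic function on all words `w` in a number of steps that is bounded
by a polynomial in the length of `w`. Mathlib's machines have finitely many stacks, labels and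
internal states; we also ask for all of the stack alphabets to be finite. -/
def PTIME : Set (Language Bool) :=
  {L | ∃ M : Turing.TM2ComputableInPolyTime (id : List Bool → List Bool) Computability.encodeBool
      (fun w => decide (w ∈ L)), ∀ k, Finite (M.tm.Γ k)}

end PawnGames

/-! There are exponentially many configurations, but the outcome depends only on the vertex that
holds the token and on the player who moves it. Suppose the token has just reached `v`, and let `o`
be the unique owner of `v`. The player who did not move must transfer some pawn `j`. Taking `j = o`
flips the control of `v`; any other pawn leaves it unchanged. With two or more pawns the chooser
thus picks the next mover freely. With a single pawn that pawn changes hands every time, and the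
players alternate. This is `PawnGame.exists_edge_mover_iff`.

The attractor of the target in the game on configurations (`TurnBasedGame.playerOneWins_iff`)
therefore projects to an iteration `PawnGame.winners` on pairs of a player and a vertex
(`PawnGame.mem_stage_iff_winners`). There are only `2 * n` such pairs, so this increasing iteration
is stationary after `2 * n` rounds (`PawnGame.winners_of_winners`), and a round amounts to
polynomially many lookups in the input.

For the Turing machine bound, a small structured language on stacks of bits is simulated step by
step by machines (`Exec.iterate_step`). Functions computed by its programs in polynomial time form a
class `PolyTime`. It is closed under branching and under iteration whose values grow by a bounded
amount per round (`PolyTime.countdown`). The decision procedure `accept` is assembled from these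
closure properties, and `accept_iff` shows that it decides the language, malformed words included.
-/

/-! ### Structured programs on finitely many stacks of bits -/

namespace StackProgram

open Function Turing StateTransition

/-- The contents of the stacks. -/
abbrev Store := ℕ → List Bool

/-- Structured programs that operate on stacks of bits and on a register, which holds the bit that
was popped last (or `none`, if the stack was empty). -/
inductive Prog
  | push (i : ℕ) (f : Option Bool → Bool)
  | pop (i : ℕ)
  | seq (p q : Prog)
  | ite (c : Option Bool → Bool) (p q : Prog)
  | loop (c : Option Bool → Bool) (p : Prog)

/-- `Exec p s S s' S' t`: started with register `s` and stacks `S`, the program `p` stops after `t`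
steps with register `s'` and stacks `S'`. -/
inductive Exec : Prog → Option Bool → Store → Option Bool → Store → ℕ → Prop
  | push (i f s S) : Exec (.push i f) s S s (update S i (f s :: S i)) 1
  | pop (i s S) : Exec (.pop i) s S (S i).head? (update S i (S i).tail) 1
  | seq {p q s S s' S' s'' S'' t t'} : Exec p s S s' S' t → Exec q s' S' s'' S'' t' →
      Exec (.seq p q) s S s'' S'' (t + t')
  | ite_true {c p q s S s' S' t} : c s = true → Exec p s S s' S' t →
      Exec (.ite c p q) s S s' S' (1 + t)
  | ite_false {c p q s S s' S' t} : c s = false → Exec q s S s' S' t →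
      Exec (.ite c p q) s S s' S' (1 + t)
  | loop_false {c p s S} : c s = false → Exec (.loop c p) s S s S 1
  | loop_true {c p s S s' S' s'' S'' t t'} : c s = true → Exec p s S s' S' t →
      Exec (.loop c p) s' S' s'' S'' t' → Exec (.loop c p) s S s'' S'' (1 + (t + t'))

theorem Exec.congr {p s S s' S' S'' t t'} (h : Exec p s S s' S' t) (hS : S' = S'') (ht : t = t') :
    Exec p s S s' S'' t' := hS ▸ ht ▸ h

/-! #### Translation to Mathlib's Turing machines -/

/-- The labels of the machine that runs a program. -/
def Prog.Label : Prog → Type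
  | push _ _ => Unit
  | pop _ => Unit
  | seq p q => p.Label ⊕ q.Label
  | ite _ p q => Option (p.Label ⊕ q.Label)
  | .loop _ p => Option p.Label

/-- A program has only finitely many labels. -/
@[reducible]
noncomputable def Prog.fintypeLabel : (p : Prog) → Fintype p.Label
  | push _ _ => inferInstanceAs (Fintype Unit)
  | pop _ => inferInstanceAs (Fintype Unit)
  | seq p q => @instFintypeSum _ _ p.fintypeLabel q.fintypeLabel
  | ite _ p q => @instFintypeOption _ (@instFintypeSum _ _ p.fintypeLabel q.fintypeLabel)
  | .loop _ p => @instFintypeOption _ p.fintypeLabel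

/-- The label at which a program starts. -/
def Prog.entry : (p : Prog) → p.Label
  | push _ _ => ()
  | pop _ => ()
  | seq p _ => Sum.inl p.entry
  | ite _ _ _ => none
  | .loop _ _ => none

/-- All stacks that a program uses have an index below `N`. -/
def Prog.UsesBelow (N : ℕ) : Prog → Prop
  | push i _ => i < N
  | pop i => i < N
  | seq p q => p.UsesBelow N ∧ q.UsesBelow N
  | ite _ p q => p.UsesBelow N ∧ q.UsesBelow N
  | .loop _ p => p.UsesBelow N

theorem Prog.UsesBelow.mono {M N : ℕ} (h : M ≤ N) {p : Prog} (hp : p.UsesBelow M) :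
    p.UsesBelow N := by
  induction p with
  | push i f => exact lt_of_lt_of_le hp h
  | pop i => exact lt_of_lt_of_le hp h
  | seq p q ihp ihq => exact ⟨ihp hp.1, ihq hp.2⟩
  | ite c p q ihp ihq => exact ⟨ihp hp.1, ihq hp.2⟩
  | loop c p ih => exact ih hp

theorem Prog.exists_usesBelow (p : Prog) : ∃ N, p.UsesBelow N := by
  induction p with
  | push i f => exact ⟨i + 1, Nat.lt_succ_self i⟩
  | pop i => exact ⟨i + 1, Nat.lt_succ_self i⟩
  | seq p q ihp ihq | ite c p q ihp ihq =>
    obtain ⟨M, hM⟩ := ihp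
    obtain ⟨N, hN⟩ := ihq
    exact ⟨max M N, hM.mono (le_max_left _ _), hN.mono (le_max_right _ _)⟩
  | loop c p ih => exact ih

/-- The number `i` as an index of one of `N` stacks. -/
def stackIndex (N : ℕ) [NeZero N] (i : ℕ) : Fin N := ⟨i % N, Nat.mod_lt _ (NeZero.pos N)⟩

/-- The statements of a program whose labels are embedded into `Λ` by `emb`, and which continues at
`exit` when it stops. -/
def Prog.code {N : ℕ} [NeZero N] {Λ : Type} : (p : Prog) → (emb : p.Label → Λ) → (exit : Λ) →
    p.Label → TM2.Stmt (fun _ : Fin N => Bool) Λ (Option Bool)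
  | push i f, _, exit => fun _ => .push (stackIndex N i) f (.goto fun _ => exit)
  | pop i, _, exit => fun _ => .pop (stackIndex N i) (fun _ a => a) (.goto fun _ => exit)
  | seq p q, emb, exit => fun l => match l with
    | .inl l => p.code (emb ∘ Sum.inl) (emb (Sum.inr q.entry)) l
    | .inr l => q.code (emb ∘ Sum.inr) exit l
  | ite c p q, emb, exit => fun l => match l with
    | none => .branch c (.goto fun _ => emb (some (Sum.inl p.entry)))
        (.goto fun _ => emb (some (Sum.inr q.entry)))
    | some (.inl l) => p.code (emb ∘ some ∘ Sum.inl) exit l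
    | some (.inr l) => q.code (emb ∘ some ∘ Sum.inr) exit l
  | .loop c p, emb, exit => fun l => match l with
    | none => .branch c (.goto fun _ => emb (some p.entry)) (.goto fun _ => exit)
    | some l => p.code (emb ∘ some) (emb none) l

/-- The first `N` stacks of a store. -/
def Store.restrict (N : ℕ) (S : Store) : Fin N → List Bool := fun k => S k

theorem Store.restrict_update {N : ℕ} [NeZero N] {i : ℕ} (hi : i < N) (S : Store) (l : List Bool) :
    update (S.restrict N) (stackIndex N i) l = Store.restrict N (update S i l) := by
  funext k
  have : k = stackIndex N i ↔ (k : ℕ) = i := by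
    simp only [Fin.ext_iff, stackIndex, Nat.mod_eq_of_lt hi]
  simp [Store.restrict, Function.update_apply, this]

theorem Store.restrict_apply {N : ℕ} [NeZero N] {i : ℕ} (hi : i < N) (S : Store) :
    S.restrict N (stackIndex N i) = S i := by
  simp [Store.restrict, stackIndex, Nat.mod_eq_of_lt hi]

/-- Steps of a program and of its machine correspond one to one. `exit` is generalized because a
subprogram exits to the entry of whatever follows it, or to the test of its loop. -/
theorem Exec.iterate_step {N : ℕ} [NeZero N] {Λ : Type}
    {M : Λ → TM2.Stmt (fun _ : Fin N => Bool) Λ (Option Bool)} {p s S s' S' t}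
    (h : Exec p s S s' S' t) (hN : p.UsesBelow N) (emb : p.Label → Λ) (exit : Λ)
    (hM : ∀ l, M (emb l) = p.code emb exit l) :
    (flip bind (TM2.step M))^[t] (some ⟨some (emb p.entry), s, S.restrict N⟩) =
      some ⟨some exit, s', S'.restrict N⟩ := by
  induction h generalizing exit with
  | push i f s S =>
    have hi : i < N := hN
    simp [hM, Prog.code, Store.restrict_update hi, Store.restrict_apply hi, flip]
  | pop i s S =>
    have hi : i < N := hN
    simp [hM, Prog.code, Store.restrict_update hi, Store.restrict_apply hi, flip]
  | @seq p q s S s' S' s'' S'' t t' _ _ ihp ihq =>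
    rw [add_comm, iterate_add_apply]
    refine Eq.trans (congrArg _ (ihp hN.1 (emb ∘ Sum.inl) (emb (Sum.inr q.entry)) fun l => ?_))
      (ihq hN.2 (emb ∘ Sum.inr) exit fun l => ?_) <;> exact hM _
  | @ite_true c p q s S s' S' t hc _ ih =>
    have hM' : ∀ l : Option (p.Label ⊕ q.Label), M (emb l) = _ := hM
    rw [add_comm, iterate_add_apply]
    refine Eq.trans (congrArg _ ?_) (ih hN.1 (emb ∘ some ∘ Sum.inl) exit fun l => hM _)
    simp [Prog.entry, hM' none, Prog.code, hc, flip]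
    rfl
  | @ite_false c p q s S s' S' t hc _ ih =>
    have hM' : ∀ l : Option (p.Label ⊕ q.Label), M (emb l) = _ := hM
    rw [add_comm, iterate_add_apply]
    refine Eq.trans (congrArg _ ?_) (ih hN.2 (emb ∘ some ∘ Sum.inr) exit fun l => hM _)
    simp [Prog.entry, hM' none, Prog.code, hc, flip]
    rfl
  | @loop_false c p s S hc =>
    have hM' : ∀ l : Option p.Label, M (emb l) = _ := hM
    simp [Prog.entry, hM' none, Prog.code, hc, flip]
  | @loop_true c p s S s' S' s'' S'' t t' hc _ _ ihp ihw =>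
    have hM' : ∀ l : Option p.Label, M (emb l) = _ := hM
    rw [add_comm, iterate_add_apply, add_comm t, iterate_add_apply]
    refine Eq.trans (congrArg _ (Eq.trans (congrArg _ ?_)
      (ihp hN (emb ∘ some) (emb none) fun l => hM _))) (ihw hN emb exit hM)
    simp [Prog.entry, hM' none, Prog.code, hc, flip]
    rfl

/-- The machine that runs the program `p` on `N + 2` stacks, with its input on stack `0` and its
output on stack `1`. -/
noncomputable def Prog.machine (p : Prog) (N : ℕ) : FinTM2 :=
  letI := p.fintypeLabel
  { K := Fin (N + 2)
    k₀ := 0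
    k₁ := 1
    Γ := fun _ => Bool
    Λ := Option p.Label
    main := some p.entry
    σ := Option Bool
    initialState := none
    m := fun l => match l with
      | none => .halt
      | some l => p.code some none l }

theorem Exec.outputsInTime {p : Prog} {N : ℕ} (hN : p.UsesBelow N) {v w : List Bool} {t : ℕ}
    (h : Exec p none (update (fun _ => []) 0 v) none (update (fun _ => []) 1 w) t) :
    Nonempty (TM2OutputsInTime (p.machine N) v (some w) (t + 1)) := by
  refine ⟨⟨⟨t + 1, ?_⟩, le_rfl⟩⟩
  -- The additional step executes `halt` at the exit label.
  rw [add_comm, iterate_add_apply]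
  have h' := h.iterate_step (N := N + 2) (M := (p.machine N).m) (hN.mono (Nat.le_add_right _ _))
    some none fun l => rfl
  have hi : initList (p.machine N) v =
      ⟨some (some p.entry), none, Store.restrict (N + 2) (update (fun _ => []) 0 v)⟩ := by
    refine congrArg (TM2.Cfg.mk _ _) (funext fun (k : Fin (N + 2)) => ?_)
    change (if h : k = 0 then _ else _) = _
    split_ifs with hk
    · subst hk; rfl
    · have : (k : ℕ) ≠ 0 := fun h => hk (Fin.ext h)
      exact (update_of_ne this v fun _ => []).symm
  have ho : haltList (p.machine N) w =
      ⟨none, none, Store.restrict (N + 2) (update (fun _ => []) 1 w)⟩ := by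
    refine congrArg (TM2.Cfg.mk _ _) (funext fun (k : Fin (N + 2)) => ?_)
    change (if h : k = 1 then _ else _) = _
    split_ifs with hk
    · subst hk; rfl
    · have : (k : ℕ) ≠ 1 := fun h => hk (Fin.ext h)
      exact (update_of_ne this w fun _ => []).symm
  rw [hi]
  refine Eq.trans (congrArg _ h') ?_
  exact congrArg some ho.symm

/-! ### Basic programs -/

/-- `Runs p S S' t`: the program `p` transforms the stacks `S` into `S'` in at most `t` steps,
whatever the register holds. -/
def Runs (p : Prog) (S S' : Store) (t : ℕ) : Prop :=
  ∀ s, ∃ s' t', Exec p s S s' S' t' ∧ t' ≤ t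

theorem Runs.mono {p S S' t t'} (h : Runs p S S' t) (ht : t ≤ t') : Runs p S S' t' := fun s =>
  let ⟨s', u, hu, h'⟩ := h s
  ⟨s', u, hu, h'.trans ht⟩

theorem Runs.seq {p q S S' S'' t t'} (hp : Runs p S S' t) (hq : Runs q S' S'' t') :
    Runs (.seq p q) S S'' (t + t') := fun s =>
  let ⟨s', _, hu, h⟩ := hp s
  let ⟨s'', _, hu', h'⟩ := hq s'
  ⟨s'', _, hu.seq hu', add_le_add h h'⟩

theorem Runs.push (i : ℕ) (b : Bool) (S : Store) :
    Runs (.push i fun _ => b) S (update S i (b :: S i)) 1 := fun s =>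
  ⟨s, 1, .push _ _ _ _, le_rfl⟩

theorem Runs.pop (i : ℕ) (S : Store) : Runs (.pop i) S (update S i (S i).tail) 1 := fun s =>
  ⟨_, 1, .pop _ s _, le_rfl⟩

/-- Pop the bits of stack `i` one by one, and run `p` after each of them. -/
def Prog.drain (i : ℕ) (p : Prog) : Prog :=
  .seq (.pop i) (.loop Option.isSome (.seq p (.pop i)))

theorem Exec.drain_nil {i p s S} (h : S i = []) : Exec (.drain i p) s S none S 2 := by
  have hS : update S i (S i).tail = S := by rw [h, List.tail_nil, ← h, update_eq_self]
  have h1 := Exec.pop i s S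
  rw [hS, h] at h1
  exact h1.seq (.loop_false rfl)

/-- The pop that opens the remaining drain doubles as the pop that ends the first round. The two
additional steps are the first pop and the loop test. -/
theorem Exec.drain_cons {i p s S a l s' S' S'' t t'} (h : S i = a :: l)
    (hp : Exec p (some a) (update S i l) s' S' t) (hd : Exec (.drain i p) s' S' none S'' t') :
    Exec (.drain i p) s S none S'' (t + t' + 2) := by
  cases hd with
  | seq h1 h2 =>
    cases h1
    have h0 := Exec.pop i s S
    rw [h] at h0
    exact (h0.seq (.loop_true (c := Option.isSome) rfl (hp.seq (.pop i s' S')) h2)).congr rfl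
      (by omega)

theorem Exec.loop_register {w s S s' S' t} (h : Exec w s S s' S' t) {c p} (hw : w = .loop c p) :
    c s' = false := by
  induction h with
  | loop_false hc => cases hw; exact hc
  | loop_true _ _ _ _ ih => exact ih hw
  | _ => cases hw

theorem Exec.drain_register {i p s S s' S' t} (h : Exec (.drain i p) s S s' S' t) : s' = none := by
  cases h with
  | seq _ hw => simpa using hw.loop_register rfl

/-- Pop all bits of stack `i`, and push their images under `f` onto stack `j`. -/
def Prog.move (i j : ℕ) (f : Option Bool → Bool) : Prog := .drain i (.push j f)

theorem Exec.move {i j : ℕ} (hij : i ≠ j) (f : Option Bool → Bool) (s : Option Bool) (S : Store) :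
    Exec (.move i j f) s S none
      (update (update S i []) j (((S i).map fun a => f (some a)).reverse ++ S j))
      (3 * (S i).length + 2) := by
  generalize hl : S i = l
  induction l generalizing s S with
  | nil =>
    refine (Exec.drain_nil hl).congr ?_ rfl
    rw [← hl, update_eq_self, hl]
    simp
  | cons a l ih =>
    refine (Exec.drain_cons hl (.push _ _ _ _) (ih (some a) _ ?_)).congr ?_ ?_
    · simp [update_of_ne hij]
    · funext k
      simp only [update_apply]
      split_ifs <;> simp_all
    · simp; ring

/-- Remove all bits of stack `i`. -/
def Prog.clear (i : ℕ) : Prog := .drain i (.seq (.push i fun _ => true) (.pop i))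

theorem Exec.clear (i : ℕ) (s : Option Bool) (S : Store) :
    Exec (.clear i) s S none (update S i []) (4 * (S i).length + 2) := by
  generalize hl : S i = l
  induction l generalizing s S with
  | nil => exact (Exec.drain_nil hl).congr (by rw [← hl, update_eq_self]) rfl
  | cons a l ih =>
    -- Pushing a bit and popping it again serves as an empty loop body.
    refine (Exec.drain_cons hl (.seq (.push _ _ _ _) (.pop _ _ _)) (ih _ _ ?_)).congr ?_ ?_
    · simp
    · simp
    · simp; ring

theorem Runs.clear (i : ℕ) (S : Store) :
    Runs (.clear i) S (update S i []) (4 * (S i).length + 2) := fun s =>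
  ⟨none, _, .clear i s S, le_rfl⟩

theorem Runs.move {i j : ℕ} (hij : i ≠ j) (f : Option Bool → Bool) (S : Store) :
    Runs (.move i j f) S
      (update (update S i []) j (((S i).map fun a => f (some a)).reverse ++ S j))
      (3 * (S i).length + 2) := fun s =>
  ⟨none, _, .move hij f s S, le_rfl⟩

/-- Replace stack `j` by stack `i`, by way of the empty stack `k`. -/
def Prog.transfer (i j k : ℕ) : Prog :=
  .seq (.clear j) (.seq (.move i k fun a => a.getD true) (.move k j fun a => a.getD true))

/-- A move reverses the order of the bits, so two moves restore it. The default of `getD` never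
matters, since the body of a drain only runs on a popped bit. -/
theorem Runs.transfer {i j k : ℕ} (hij : i ≠ j) (hik : i ≠ k) (hjk : j ≠ k) (S : Store)
    (hk : S k = []) :
    Runs (.transfer i j k) S (update (update S i []) j (S i))
      (4 * (S j).length + 6 * (S i).length + 6) := by
  have h1 := Runs.clear j S
  have h2 := Runs.move hik (fun a => a.getD true) (update S j [])
  have h3 := Runs.move hjk.symm (fun a => a.getD true) (update (update (update S j []) i [])
    k (((update S j [] i).map fun a => (some a).getD true).reverse ++ update S j [] k))
  have h := h1.seq (h2.seq h3)
  have e : ∀ l : List Bool, l.map (fun a => (some a).getD true) = l := fun l => by simp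
  simp only [update_of_ne hij, update_of_ne hjk.symm, hk, List.append_nil, e, update_self,
    List.length_reverse, List.reverse_reverse, update_of_ne hjk, update_of_ne hij.symm] at h
  have e2 : update (update (update (update (update S j []) i []) k (S i).reverse) k []) j (S i) =
      update (update S i []) j (S i) := by
    funext l
    simp only [update_apply]
    split_ifs <;> simp_all
  rw [e2] at h
  exact h.mono (by omega)

/-- Copy stack `i` to the empty stack `j`, by way of the empty stack `k`. -/
def Prog.copy (i j k : ℕ) : Prog :=
  .seq (.move i k fun a => a.getD true)
    (.drain k (.seq (.push i fun a => a.getD true) (.push j fun a => a.getD true)))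

theorem Runs.copy {i j k : ℕ} (hij : i ≠ j) (hik : i ≠ k) (hjk : j ≠ k) (S : Store)
    (hj : S j = []) (hk : S k = []) :
    Runs (.copy i j k) S (update S j (S i)) (7 * (S i).length + 4) := by
  have key : ∀ (l : List Bool) (s : Option Bool) (S : Store), S k = l →
      Exec (.drain k (.seq (.push i fun a => a.getD true) (.push j fun a => a.getD true))) s S none
        (update (update (update S k []) i (l.reverse ++ S i)) j (l.reverse ++ S j))
        (4 * l.length + 2) := by
    intro l
    induction l with
    | nil =>
      intro s S hl
      refine (Exec.drain_nil hl).congr ?_ rfl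
      rw [← hl, update_eq_self]
      simp [hl]
    | cons a l ih =>
      intro s S hl
      refine (Exec.drain_cons hl (.seq (.push _ _ _ _) (.push _ _ _ _)) (ih _ _ ?_)).congr ?_ ?_
      · simp [update_of_ne hjk.symm, update_of_ne hik.symm]
      · funext x
        simp only [update_apply]
        split_ifs <;> simp_all
      · simp; ring
  intro s
  refine ⟨none, _, ((Exec.move hik (fun a => a.getD true) s S).seq (key _ _ _ rfl)).congr ?_ rfl, ?_⟩
  · have e : ∀ l : List Bool, l.map (fun a => (some a).getD true) = l := fun l => by simp
    funext x
    simp only [update_apply, e]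
    split_ifs <;> simp_all
  · have e : ∀ l : List Bool, l.map (fun a => (some a).getD true) = l := fun l => by simp
    simp [hk]
    omega

/-! ### Polynomial time -/

/-- A list of functions on `α`: the data that a program can access. -/
abbrev Context (α : Type) := List (α → List Bool)

/-- The total length of the data of a context. -/
def Context.size {α : Type} (xs : Context α) (a : α) : ℕ := (xs.map fun x => (x a).length).sum

theorem eval_mono (q : Polynomial ℕ) : Monotone fun n => q.eval n := by
  intro m n h
  simp only [Polynomial.eval_eq_sum_range]
  gcongr

/-- The function `g` is bounded by a polynomial in the size of the context `xs`. -/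
def PolyBound {α : Type} (xs : Context α) (g : α → ℕ) : Prop :=
  ∃ q : Polynomial ℕ, ∀ a, g a ≤ q.eval (xs.size a)

namespace PolyBound

variable {α : Type} {xs : Context α} {g h : α → ℕ}

theorem const (k : ℕ) : PolyBound xs fun _ => k := ⟨Polynomial.C k, by simp⟩

theorem size : PolyBound xs xs.size := ⟨Polynomial.X, by simp⟩

theorem add (hg : PolyBound xs g) (hh : PolyBound xs h) : PolyBound xs fun a => g a + h a := by
  obtain ⟨p, hp⟩ := hg
  obtain ⟨q, hq⟩ := hh
  exact ⟨p + q, fun a => by simpa using add_le_add (hp a) (hq a)⟩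

theorem mul (hg : PolyBound xs g) (hh : PolyBound xs h) : PolyBound xs fun a => g a * h a := by
  obtain ⟨p, hp⟩ := hg
  obtain ⟨q, hq⟩ := hh
  exact ⟨p * q, fun a => by simpa using mul_le_mul' (hp a) (hq a)⟩

theorem comp (q : Polynomial ℕ) (hg : PolyBound xs g) : PolyBound xs fun a => q.eval (g a) := by
  obtain ⟨p, hp⟩ := hg
  exact ⟨q.comp p, fun a => by simpa using eval_mono q (hp a)⟩

theorem mono (hg : PolyBound xs g) (h' : ∀ a, h a ≤ g a) : PolyBound xs h := by
  obtain ⟨p, hp⟩ := hg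
  exact ⟨p, fun a => (h' a).trans (hp a)⟩

theorem subst {β : Type} {ys : Context β} {r : α → β} (hr : PolyBound xs fun a => ys.size (r a))
    {g : β → ℕ} (hg : PolyBound ys g) : PolyBound xs fun a => g (r a) := by
  obtain ⟨p, hp⟩ := hg
  exact (hr.comp p).mono fun a => hp _

end PolyBound

/-- The function `f` can be computed in polynomial time from the context `xs`: for all positions `ps`
of the data on stacks below `m`, there is a program that writes `f a` on stack `m`, in a number of
steps that is polynomial in the size of the data. It may use the stacks above `m`, which have to be
empty. -/
structure PolyTime {α : Type} (xs : Context α) (f : α → List Bool) : Prop where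
  length : PolyBound xs fun a => (f a).length
  exists_prog : ∀ (ps : List ℕ) (m : ℕ), ps.length = xs.length → (∀ i ∈ ps, i < m) →
    ∃ (p : Prog) (t : α → ℕ), PolyBound xs t ∧ ∀ (a : α) (S : Store),
      ps.map S = xs.map (fun x => x a) → (∀ k, m ≤ k → S k = []) →
        Runs p S (update S m (f a)) (t a)

theorem map_update_of_lt {ps : List ℕ} {m : ℕ} (hps : ∀ i ∈ ps, i < m) {S : Store} {k : ℕ}
    (hk : m ≤ k) (l : List Bool) : ps.map (update S k l) = ps.map S :=
  List.map_congr_left fun i hi => update_of_ne (((hps i hi).trans_le hk).ne) _ _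

/-- `Nat.rec`, with the counter running downwards. -/
def countdown {β : Type} (f : ℕ → β → β) : ℕ → β → β
  | 0, z => z
  | n + 1, z => countdown f n (f n z)

/-- The unary encoding of a number as a list of bits. -/
def nat (k : ℕ) : List Bool := List.replicate k true

@[simp] theorem length_nat (k : ℕ) : (nat k).length = k := List.length_replicate

/-! ### Closure properties of polynomial time computability. -/

namespace PolyTime

variable {α : Type} {xs : Context α} {f g : α → List Bool}

theorem congr (hf : PolyTime xs f) (h : ∀ a, f a = g a) : PolyTime xs g := funext h ▸ hf

/-- Each entry of `ys` is read from a stack where it occurs in `xs`. Entries of `ys` may repeat,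
hence the factor `ys.length` in the comparison of the sizes. -/
theorem of_subset {ys : Context α} (hf : PolyTime ys f) (h : ys ⊆ xs) : PolyTime xs f := by
  have hs : PolyBound xs ys.size := by
    refine ((PolyBound.const ys.length).mul .size).mono fun a => ?_
    refine (List.sum_le_card_nsmul _ (xs.size a) fun n hn => ?_).trans (by simp)
    obtain ⟨y, hy, rfl⟩ := List.mem_map.1 hn
    exact List.single_le_sum (fun _ _ => Nat.zero_le _) _
      (List.mem_map.2 ⟨y, h hy, rfl⟩)
  refine ⟨hs.subst (r := id) hf.length, fun ps m hl hps => ?_⟩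
  choose! idx hidx using fun y (hy : y ∈ ys) => List.getElem?_of_mem (h hy)
  have hlt : ∀ y ∈ ys, idx y < ps.length := fun y hy => by
    rw [hl]; exact (List.getElem?_eq_some_iff.1 (hidx y hy)).1
  obtain ⟨p, t, ht, hp⟩ := hf.exists_prog (ys.map fun y => ps.getD (idx y) 0) m (by simp) <| by
    intro i hi
    obtain ⟨y, hy, rfl⟩ := List.mem_map.1 hi
    rw [List.getD_eq_getElem _ _ (hlt y hy)]
    exact hps _ (List.getElem_mem _)
  refine ⟨p, t, hs.subst (r := id) ht, fun a S hS hm => hp a S ?_ hm⟩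
  rw [List.map_map]
  refine List.map_congr_left fun y hy => ?_
  have := congrArg (·[idx y]?) hS
  simp only [List.getElem?_map, hidx y hy, List.getElem?_eq_getElem (hlt y hy), Option.map_some,
    Option.some.injEq] at this
  rw [Function.comp_apply, List.getD_eq_getElem _ _ (hlt y hy)]
  exact this

/-- The same program works, since programs see the data and not the parameter that it depends on. -/
theorem reparam {β : Type} (hf : PolyTime xs f) (r : β → α) :
    PolyTime (xs.map fun x => x ∘ r) (f ∘ r) := by
  have hs : ∀ b, Context.size (xs.map fun x => x ∘ r) b = xs.size (r b) := fun b => by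
    simp [Context.size, Function.comp_def]
  have hs' : PolyBound (xs.map fun x => x ∘ r) fun b => xs.size (r b) :=
    PolyBound.size.mono fun b => (hs b).ge
  refine ⟨hs'.subst hf.length, fun ps m hl hps => ?_⟩
  obtain ⟨p, t, ht, hp⟩ := hf.exists_prog ps m (by simpa using hl) hps
  refine ⟨p, fun b => t (r b), hs'.subst ht, fun b S hS hm => hp (r b) S ?_ hm⟩
  rw [hS, List.map_map]
  rfl

theorem var (i : ℕ) (h : xs[i]? = some f) : PolyTime xs f := by
  have hmem : f ∈ xs := List.mem_of_getElem? h
  have hb : PolyBound xs fun a => (f a).length := PolyBound.size.mono fun a =>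
    List.single_le_sum (fun _ _ => Nat.zero_le _) _ (List.mem_map.2 ⟨f, hmem, rfl⟩)
  refine ⟨hb, fun ps m hl hps => ?_⟩
  have hi : i < ps.length := by rw [hl]; exact (List.getElem?_eq_some_iff.1 h).1
  have hlt := hps _ (List.getElem_mem hi)
  refine ⟨.copy ps[i] m (m + 1), fun a => 7 * (f a).length + 4,
    ((PolyBound.const 7).mul hb).add (.const 4), fun a S hS hm => ?_⟩
  have hv : S ps[i] = f a := by
    have := congrArg (·[i]?) hS
    simpa only [List.getElem?_map, h, List.getElem?_eq_getElem hi, Option.map_some,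
      Option.some.injEq] using this
  have := Runs.copy (i := ps[i]) (j := m) (k := m + 1) (by omega) (by omega) (by omega) S
    (hm _ le_rfl) (hm _ (by omega))
  rwa [hv] at this

theorem nil : PolyTime xs fun _ => [] := by
  refine ⟨.const 0, fun ps m hl hps => ⟨.clear m, fun _ => 2, .const 2, fun a S hS hm => ?_⟩⟩
  simpa [hm m le_rfl] using Runs.clear m S

theorem cons (b : Bool) (hf : PolyTime xs f) : PolyTime xs fun a => b :: f a := by
  refine ⟨hf.length.add (.const 1), fun ps m hl hps => ?_⟩
  obtain ⟨p, t, ht, hp⟩ := hf.exists_prog ps m hl hps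
  refine ⟨.seq p (.push m fun _ => b), fun a => t a + 1, ht.add (.const 1), fun a S hS hm => ?_⟩
  simpa using (hp a S hS hm).seq (.push m b _)

theorem tail (hf : PolyTime xs f) : PolyTime xs fun a => (f a).tail := by
  refine ⟨hf.length.mono fun a => by simp, fun ps m hl hps => ?_⟩
  obtain ⟨p, t, ht, hp⟩ := hf.exists_prog ps m hl hps
  refine ⟨.seq p (.pop m), fun a => t a + 1, ht.add (.const 1), fun a S hS hm => ?_⟩
  simpa using (hp a S hS hm).seq (.pop m _)

theorem length_nat (hf : PolyTime xs f) : PolyTime xs fun a => nat (f a).length := by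
  refine ⟨hf.length.mono fun a => by simp, fun ps m hl hps => ?_⟩
  obtain ⟨p, t, ht, hp⟩ := hf.exists_prog ps m hl hps
  refine ⟨.seq p (.seq (.move m (m + 1) fun _ => true) (.move (m + 1) m fun _ => true)),
    fun a => t a + (6 * (f a).length + 4),
    ht.add (((PolyBound.const 6).mul hf.length).add (.const 4)), fun a S hS hm => ?_⟩
  have h1 := Runs.move (i := m) (j := m + 1) (by omega) (fun _ => true) (update S m (f a))
  have h2 := Runs.move (i := m + 1) (j := m) (by omega) (fun _ => true)
    (update (update (update S m (f a)) m []) (m + 1)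
      (((update S m (f a) m).map fun _ => true).reverse ++ update S m (f a) (m + 1)))
  have h := h1.seq h2
  have hm1 := hm (m + 1) (by omega)
  have e : update (update (update (update (update S m (f a)) m []) (m + 1)
      (((update S m (f a) m).map fun _ => true).reverse ++ update S m (f a) (m + 1)))
      (m + 1) []) m (nat (f a).length) = update S m (nat (f a).length) := by
    funext k
    simp only [update_apply]
    split_ifs <;> simp_all
  change Runs _ _ (update _ _ (List.replicate (f a).length true)) _
  rw [nat] at e
  simp only [update_self, update_of_ne (show m + 1 ≠ m by omega), hm1,
    update_of_ne (show m ≠ m + 1 by omega), List.append_nil, List.map_const',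
    List.reverse_replicate, List.length_replicate, List.map_replicate] at h e
  rw [e] at h
  exact (hp a S hS hm).seq (h.mono (by omega))

theorem ite {c : α → Bool} (hc : PolyTime xs fun a => [c a]) (hf : PolyTime xs f)
    (hg : PolyTime xs g) : PolyTime xs fun a => if c a then f a else g a := by
  refine ⟨(hf.length.add hg.length).mono fun a => by split_ifs <;> omega, fun ps m hl hps => ?_⟩
  obtain ⟨p, t, ht, hp⟩ := hc.exists_prog ps m hl hps
  obtain ⟨q, u, hu, hq⟩ := hf.exists_prog ps m hl hps
  obtain ⟨r, v, hv, hr⟩ := hg.exists_prog ps m hl hps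
  refine ⟨.seq p (.seq (.pop m) (.ite (fun s => s.getD true) q r)),
    fun a => t a + (1 + (1 + (u a + v a))),
    ht.add ((PolyBound.const 1).add ((PolyBound.const 1).add (hu.add hv))), fun a S hS hm => ?_⟩
  refine (hp a S hS hm).seq fun s => ?_
  have h1 := Exec.pop m s (update S m [c a])
  -- Popping the condition into the register restores the original stacks, so that either branch may
  -- write its result on stack `m`.
  have e : update S m [] = S := by rw [← hm m le_rfl, update_eq_self]
  simp only [update_self, List.head?_cons, List.tail_cons, update_idem, e] at h1
  cases hca : c a with
  | true =>
    rw [hca] at h1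
    obtain ⟨s', w, hw, hle⟩ := hq a S hS hm (some true)
    exact ⟨s', _, .seq (p := .pop m) h1 (.ite_true rfl (by simpa using hw)), by omega⟩
  | false =>
    rw [hca] at h1
    obtain ⟨s', w, hw, hle⟩ := hr a S hS hm (some false)
    exact ⟨s', _, .seq (p := .pop m) h1 (.ite_false rfl (by simpa using hw)), by omega⟩

theorem length_countdown_le {h : ℕ → List Bool → List Bool} {Q : ℕ}
    (hQ : ∀ i z, (h i z).length ≤ z.length + Q) (n : ℕ) (z : List Bool) :
    (StackProgram.countdown h n z).length ≤ z.length + n * Q := by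
  induction n generalizing z with
  | zero => simp [StackProgram.countdown]
  | succ n ih =>
    have := ih (h n z)
    have := hQ n z
    rw [StackProgram.countdown, Nat.succ_mul]
    omega

/-- The additive growth bound `Q` keeps the iteration polynomial: a step that doubled its argument
would produce exponential lengths. Here all intermediate values have length at most `(z a).length +
y a * Q a`, so each of the `y a` rounds takes polynomial time. -/
theorem countdown {y : α → ℕ} {z : α → List Bool} {h : α → ℕ → List Bool → List Bool}
    (hy : PolyTime xs fun a => nat (y a)) (hz : PolyTime xs z)
    (hh : PolyTime ((fun p => nat p.2.1) :: (fun p => p.2.2) :: xs.map fun x => x ∘ Prod.fst)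
      fun p : α × ℕ × List Bool => h p.1 p.2.1 p.2.2)
    {Q : α → ℕ} (hQ : PolyBound xs Q) (hle : ∀ a i l, (h a i l).length ≤ l.length + Q a) :
    PolyTime xs fun a => StackProgram.countdown (h a) (y a) (z a) := by
  have hyb : PolyBound xs y := hy.length.mono fun a => by simp
  refine ⟨(hz.length.add (hyb.mul hQ)).mono fun a => length_countdown_le (hle a) _ _,
    fun ps m hl hps => ?_⟩
  obtain ⟨p, t, ht, hp⟩ := hy.exists_prog ps m hl hps
  obtain ⟨q, u, hu, hq⟩ := hz.exists_prog ps (m + 1) hl fun i hi => (hps i hi).trans (by omega)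
  -- Stack `m` holds the counter, `m + 1` the current value and `m + 2` the result of the step
  -- function; `m + 3` is the auxiliary stack of the transfer. The drain pops the counter before the
  -- body runs, so the body sees the index of its round.
  obtain ⟨r, v, ⟨V, hV⟩, hr⟩ := hh.exists_prog (m :: (m + 1) :: ps) (m + 2) (by simpa using hl) <| by
    intro i hi
    rcases List.mem_cons.1 hi with rfl | hi
    · omega
    · rcases List.mem_cons.1 hi with rfl | hi
      · omega
      · exact (hps i hi).trans (by omega)
  let L : α → ℕ := fun a => (z a).length + y a * Q a
  have hL : PolyBound xs L := hz.length.add (hyb.mul hQ)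
  -- The cost of one round: the step function on the largest data that can occur, then the transfer
  -- of its result.
  let C : α → ℕ := fun a => V.eval (y a + (L a + xs.size a)) + (4 * L a + 6 * L a + 6)
  have hC : PolyBound xs C :=
    (PolyBound.comp V (hyb.add (hL.add .size))).add
      ((((PolyBound.const 4).mul hL).add ((PolyBound.const 6).mul hL)).add (.const 6))
  have hps1 : ∀ i ∈ ps, i < m + 1 := fun i hi => (hps i hi).trans (by omega)
  -- The length condition is an invariant: a round lowers `i` by one and lengthens the value by at
  -- most `Q a`.
  have key : ∀ (a : α) (i : ℕ) (l : List Bool) (S : Store), i ≤ y a → l.length + i * Q a ≤ L a →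
      ps.map S = xs.map (fun x => x a) → (∀ k, m + 2 ≤ k → S k = []) → S m = nat i →
      S (m + 1) = l → Runs (.drain m (.seq r (.transfer (m + 2) (m + 1) (m + 3)))) S
        (update (update S m []) (m + 1) (StackProgram.countdown (h a) i l))
        (i * (C a + 2) + 2) := by
    intro a i
    induction i with
    | zero =>
      intro l S _ _ _ _ hm hm1 s
      refine ⟨none, 2, (Exec.drain_nil hm).congr ?_ rfl, by simp⟩
      rw [StackProgram.countdown, ← hm1, show ([] : List Bool) = S m from hm.symm,
        update_eq_self, update_eq_self]
    | succ i ih =>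
      intro l S hi hlen hS hk hm hm1 s
      have hm' : S m = true :: nat i := hm
      set S1 := update S m (nat i) with hS1
      have hSl : (S (m + 1)).length ≤ L a := by rw [hm1]; omega
      have h1 := hr (a, i, l) S1 (by
        rw [List.map_cons, List.map_cons, hS1, map_update_of_lt hps le_rfl, hS]
        simp [Function.comp_def, hm1]) (fun k hk' => by
          rw [hS1, update_of_ne (by omega)]
          exact hk k hk')
      have h2 := Runs.transfer (i := m + 2) (j := m + 1) (k := m + 3) (by omega) (by omega)
        (by omega) (update S1 (m + 2) (h a i l)) (by
          rw [update_of_ne (by omega), hS1, update_of_ne (by omega)]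
          exact hk _ (by omega))
      have e : update (update (update S1 (m + 2) (h a i l)) (m + 2) []) (m + 1) (h a i l) =
          update S1 (m + 1) (h a i l) := by
        rw [update_idem, show update S1 (m + 2) [] = S1 from ?_]
        rw [← hk (m + 2) le_rfl, ← update_of_ne (show m + 2 ≠ m by omega) (nat i) S, ← hS1,
          update_eq_self]
      rw [update_self, e, update_of_ne (by omega), hS1, update_of_ne (by omega), hm1, ← hS1] at h2
      have hlh := hle a i l
      rw [Nat.succ_mul] at hlen
      have hv : v (a, i, l) ≤ V.eval (y a + (L a + xs.size a)) := by
        refine (hV _).trans (eval_mono V ?_)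
        have : Context.size ((fun p => nat p.2.1) :: (fun p => p.2.2) ::
            xs.map fun x => x ∘ Prod.fst) (a, i, l) = i + (l.length + xs.size a) := by
          simp [Context.size, Function.comp_def]
        rw [this]
        omega
      obtain ⟨s1, t1, ht1, hle1⟩ := (h1.seq h2) (some true)
      obtain ⟨s2, t2, ht2, hle2⟩ := ih (h a i l) (update S1 (m + 1) (h a i l)) (by omega) (by omega)
        (by rw [map_update_of_lt hps1 le_rfl, hS1, map_update_of_lt hps le_rfl, hS])
        (fun k hk' => by
          rw [update_of_ne (by omega), hS1, update_of_ne (by omega)]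
          exact hk k hk')
        (by rw [update_of_ne (by omega), hS1, update_self]) (update_self ..) s1
      obtain rfl := ht2.drain_register
      refine ⟨none, _, (Exec.drain_cons hm' ht1 ht2).congr ?_ rfl, ?_⟩
      · rw [StackProgram.countdown]
        funext k
        simp only [hS1, update_apply]
        split_ifs <;> simp_all
      · have : t1 ≤ C a := by
          refine hle1.trans ?_
          simp only [C]
          omega
        rw [Nat.succ_mul]
        omega
  refine ⟨.seq p (.seq q (.seq (.drain m (.seq r (.transfer (m + 2) (m + 1) (m + 3))))
    (.transfer (m + 1) m (m + 2)))),
    fun a => t a + (u a + (y a * (C a + 2) + 2 + (6 * L a + 6))),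
    ht.add (hu.add (((hyb.mul (hC.add (.const 2))).add (.const 2)).add
      (((PolyBound.const 6).mul hL).add (.const 6)))), fun a S hS hm => ?_⟩
  refine (hp a S hS hm).seq ?_
  refine Runs.seq (hq a (update S m (nat (y a))) ?_ ?_) ?_
  · rw [map_update_of_lt hps le_rfl, hS]
  · intro k hk
    rw [update_of_ne (by omega)]
    exact hm k (by omega)
  refine Runs.seq (key a (y a) (z a) _ le_rfl le_rfl ?_ ?_ ?_ ?_) ?_
  · rw [map_update_of_lt hps1 le_rfl, map_update_of_lt hps le_rfl, hS]
  · intro k hk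
    rw [update_of_ne (by omega), update_of_ne (by omega)]
    exact hm k (by omega)
  · rw [update_of_ne (by omega), update_self]
  · rw [update_self]
  have hlen := length_countdown_le (hle a) (y a) (z a)
  have hT := Runs.transfer (i := m + 1) (j := m) (k := m + 2) (by omega) (by omega) (by omega)
    (update (update (update (update S m (nat (y a))) (m + 1) (z a)) m []) (m + 1)
      (StackProgram.countdown (h a) (y a) (z a))) (by
        simp only [update_of_ne (show m + 2 ≠ m + 1 by omega),
          update_of_ne (show m + 2 ≠ m by omega)]
        exact hm _ (by omega))
  have hm1 := hm (m + 1) (by omega)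
  have e : update (update (update (update (update (update S m (nat (y a))) (m + 1) (z a)) m [])
      (m + 1) (StackProgram.countdown (h a) (y a) (z a))) (m + 1) []) m
      (StackProgram.countdown (h a) (y a) (z a)) =
      update S m (StackProgram.countdown (h a) (y a) (z a)) := by
    funext k
    simp only [update_apply]
    split_ifs <;> simp_all
  rw [update_self, e, update_of_ne (by omega), update_self] at hT
  exact hT.mono (by simp only [List.length_nil, L]; omega)

end PolyTime

theorem PolyTime.head {α : Type} {xs : Context α} {f : α → List Bool} (hf : PolyTime xs f) :
    PolyTime xs fun a => [(f a).headD false] := by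
  refine ⟨.const 1, fun ps m hl hps => ?_⟩
  obtain ⟨p, t, ht, hp⟩ := hf.exists_prog ps m hl hps
  refine ⟨.seq p (.seq (.pop m) (.ite (fun s => s.getD false)
    (.seq (.clear m) (.push m fun _ => true)) (.seq (.clear m) (.push m fun _ => false)))),
    fun a => t a + (4 * (f a).length + 5),
    ht.add (((PolyBound.const 4).mul hf.length).add (.const 5)), fun a S hS hm => ?_⟩
  refine (hp a S hS hm).seq fun s => ?_
  have h1 := Exec.pop m s (update S m (f a))
  have h2 : ∀ b, Runs (.seq (.clear m) (.push m fun _ => b)) (update S m (f a).tail)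
      (update S m [b]) (4 * (f a).length + 3) := fun b => by
    have := (Runs.clear m (update S m (f a).tail)).seq (.push m b _)
    simp only [update_self, update_idem] at this
    exact this.mono (by simp only [List.length_tail]; omega)
  simp only [update_self, update_idem] at h1
  obtain ⟨s', u, hu, hle⟩ := h2 ((f a).headD false) (f a).head?
  refine ⟨s', 1 + (1 + u), .seq (p := .pop m) h1 ?_, by omega⟩
  have e : (f a).headD false = (f a).head?.getD false := List.headD_eq_head?_getD
  rw [e] at hu ⊢
  cases hc : (f a).head?.getD false with
  | true => exact .ite_true hc (by simpa only [hc] using hu)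
  | false => exact .ite_false hc (by simpa only [hc] using hu)

namespace PolyTime

variable {α : Type} {xs : Context α}

theorem lift {β : Type} {f : α → List Bool} (hf : PolyTime xs f) {ys : Context (α × β)}
    (h : (xs.map fun x => x ∘ Prod.fst) ⊆ ys) : PolyTime ys fun p => f p.1 :=
  (hf.reparam Prod.fst).of_subset h

theorem const : (l : List Bool) → PolyTime xs fun _ => l
  | [] => nil
  | b :: l => (const l).cons b

/-! #### Boolean functions -/

section Bool

variable {c d : α → Bool}

theorem not (hc : PolyTime xs fun a => [c a]) : PolyTime xs fun a => [!c a] :=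
  (hc.ite (const [false]) (const [true])).congr fun a => by cases c a <;> rfl

theorem and (hc : PolyTime xs fun a => [c a]) (hd : PolyTime xs fun a => [d a]) :
    PolyTime xs fun a => [c a && d a] :=
  (hc.ite hd (const [false])).congr fun a => by cases c a <;> rfl

theorem or (hc : PolyTime xs fun a => [c a]) (hd : PolyTime xs fun a => [d a]) :
    PolyTime xs fun a => [c a || d a] :=
  (hc.ite (const [true]) hd).congr fun a => by cases c a <;> rfl

theorem cond (hc : PolyTime xs fun a => [c a]) {d' : α → Bool} (hd : PolyTime xs fun a => [d a])
    (hd' : PolyTime xs fun a => [d' a]) : PolyTime xs fun a => [bif c a then d a else d' a] :=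
  (hc.ite hd hd').congr fun a => by cases c a <;> rfl

end Bool

/-! #### Numbers and indices -/

section Nat

variable {f : α → List Bool} {k l : α → ℕ}

theorem drop (hf : PolyTime xs f) (hk : PolyTime xs fun a => nat (k a)) :
    PolyTime xs fun a => (f a).drop (k a) := by
  refine (countdown (h := fun _ _ l => l.tail) hk hf (var 1 rfl).tail (.const 0)
    fun a i l => by simp).congr fun a => ?_
  generalize f a = w
  induction k a generalizing w with
  | zero => rfl
  | succ n ih => rw [StackProgram.countdown, ih, ← List.drop_one, List.drop_drop, add_comm]

theorem getD (hf : PolyTime xs f) (hk : PolyTime xs fun a => nat (k a)) :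
    PolyTime xs fun a => [(f a).getD (k a) false] :=
  (hf.drop hk).head.congr fun a => by
    rw [List.headD_eq_head?_getD, List.head?_drop, List.getD_eq_getElem?_getD]

theorem succ (hk : PolyTime xs fun a => nat (k a)) : PolyTime xs fun a => nat (k a + 1) :=
  hk.cons true

theorem countdown_cons (n : ℕ) (w : List Bool) :
    StackProgram.countdown (fun _ l => true :: l) n w = nat n ++ w := by
  induction n generalizing w with
  | zero => rfl
  | succ n ih =>
    rw [StackProgram.countdown, ih, nat, nat, List.replicate_succ', List.append_assoc]
    rfl

theorem nat_append (hk : PolyTime xs fun a => nat (k a)) (hf : PolyTime xs f) :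
    PolyTime xs fun a => nat (k a) ++ f a :=
  (countdown (h := fun _ _ l => true :: l) hk hf ((var 1 rfl).cons true) (.const 1)
    fun a i l => by simp).congr fun a => countdown_cons _ _

theorem add (hk : PolyTime xs fun a => nat (k a)) (hl : PolyTime xs fun a => nat (l a)) :
    PolyTime xs fun a => nat (k a + l a) :=
  (hk.nat_append hl).congr fun a => by simp [nat]

theorem mul (hk : PolyTime xs fun a => nat (k a)) (hl : PolyTime xs fun a => nat (l a)) :
    PolyTime xs fun a => nat (k a * l a) := by
  refine (countdown (h := fun a _ w => nat (l a) ++ w) (Q := l) hk nil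
    (nat_append (k := fun p : α × ℕ × List Bool => l p.1) (hl.lift fun x hx => by simp_all) (var 1 rfl))
    (hl.length.mono fun a => by simp) fun a i w => by simp [add_comm]).congr fun a => ?_
  have key : ∀ n w, StackProgram.countdown (fun _ w => nat (l a) ++ w) n w =
      nat (n * l a) ++ w := by
    intro n
    induction n with
    | zero => intro w; simp [StackProgram.countdown, nat]
    | succ n ih =>
      intro w
      rw [StackProgram.countdown, ih, ← List.append_assoc, Nat.succ_mul, nat, nat, nat,
        List.replicate_add]
  rw [key, List.append_nil]

theorem sub (hk : PolyTime xs fun a => nat (k a)) (hl : PolyTime xs fun a => nat (l a)) :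
    PolyTime xs fun a => nat (k a - l a) :=
  (hk.drop hl).congr fun a => by simp [nat]

theorem lt (hk : PolyTime xs fun a => nat (k a)) (hl : PolyTime xs fun a => nat (l a)) :
    PolyTime xs fun a => [decide (k a < l a)] :=
  (hl.sub hk).head.congr fun a => by
    by_cases h : k a < l a
    · obtain ⟨n, hn⟩ := Nat.exists_eq_succ_of_ne_zero (Nat.sub_ne_zero_of_lt h)
      simp [hn, h, nat, List.replicate_succ]
    · simp [Nat.sub_eq_zero_of_le (not_lt.1 h), h, nat]

theorem beq (hk : PolyTime xs fun a => nat (k a)) (hl : PolyTime xs fun a => nat (l a)) :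
    PolyTime xs fun a => [k a == l a] :=
  ((hk.lt hl).not.and (hl.lt hk).not).congr fun a => by
    rcases lt_trichotomy (k a) (l a) with h | h | h
    · simp [h, h.ne]
    · simp [h]
    · simp [h, h.ne']

end Nat

/-! #### Bounded quantifiers -/

section Range

variable {k : α → ℕ} {c : α → ℕ → Bool}

/-- Adapts a condition on the index to the context of `countdown`, where the accumulator is also
present. -/
theorem counter (hc : PolyTime ((fun p => nat p.2) :: xs.map fun x => x ∘ Prod.fst)
      fun p : α × ℕ => [c p.1 p.2]) :
    PolyTime ((fun p => nat p.2.1) :: (fun p => p.2.2) :: xs.map fun x => x ∘ Prod.fst)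
      fun p : α × ℕ × List Bool => [c p.1 p.2.1] := by
  refine (hc.reparam fun p : α × ℕ × List Bool => (p.1, p.2.1)).of_subset fun x hx => ?_
  simp only [List.map_cons, List.map_map, List.mem_cons, List.mem_map] at hx ⊢
  rcases hx with rfl | ⟨y, hy, rfl⟩
  · exact Or.inl rfl
  · exact Or.inr (Or.inr ⟨y, hy, rfl⟩)

theorem map_range (hk : PolyTime xs fun a => nat (k a))
    (hc : PolyTime ((fun p => nat p.2) :: xs.map fun x => x ∘ Prod.fst)
      fun p : α × ℕ => [c p.1 p.2]) :
    PolyTime xs fun a => (List.range (k a)).map (c a) := by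
  refine (countdown (h := fun a i l => if c a i then true :: l else false :: l) hk nil
    (hc.counter.ite ((var 1 rfl).cons true) ((var 1 rfl).cons false)) (.const 1)
    fun a i l => by split_ifs <;> simp).congr fun a => ?_
  -- The counter runs downwards, so prepending bits lists them in ascending order.
  have key : ∀ n w, StackProgram.countdown
      (fun i l => if c a i then true :: l else false :: l) n w = (List.range n).map (c a) ++ w := by
    intro n
    induction n with
    | zero => intro w; rfl
    | succ n ih =>
      intro w
      rw [StackProgram.countdown, ih, List.range_succ]
      cases h : c a n <;> simp [h]
  rw [key, List.append_nil]

theorem any (hk : PolyTime xs fun a => nat (k a))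
    (hc : PolyTime ((fun p => nat p.2) :: xs.map fun x => x ∘ Prod.fst)
      fun p : α × ℕ => [c p.1 p.2]) :
    PolyTime xs fun a => [(List.range (k a)).any (c a)] := by
  refine (countdown (h := fun a i l => if c a i then [true] else l) hk (const [false])
    (hc.counter.ite (const [true]) (var 1 rfl)) (.const 1)
    fun a i l => by split_ifs <;> simp).congr fun a => ?_
  have key : ∀ n b, StackProgram.countdown (fun i l => if c a i then [true] else l) n [b] =
      [(List.range n).any (c a) || b] := by
    intro n
    induction n with
    | zero => intro b; simp [StackProgram.countdown]
    | succ n ih =>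
      intro b
      rw [StackProgram.countdown, List.range_succ]
      cases h : c a n <;> simp [h, ih]
  rw [key, Bool.or_false]

theorem all (hk : PolyTime xs fun a => nat (k a))
    (hc : PolyTime ((fun p => nat p.2) :: xs.map fun x => x ∘ Prod.fst)
      fun p : α × ℕ => [c p.1 p.2]) :
    PolyTime xs fun a => [(List.range (k a)).all (c a)] :=
  (hk.any (c := fun a i => !c a i) hc.not).not.congr fun a => by
    simp [List.not_any_eq_all_not]

end Range

/-- The number of leading ones of a word. -/
theorem leadingOnes {f : α → List Bool} (hf : PolyTime xs f) :
    PolyTime xs fun a => nat ((f a).takeWhile id).length := by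
  refine (countdown (h := fun a i l => if (f a).getD i false then true :: l else [])
    hf.length_nat nil
    (((hf.lift fun x hx => by simp_all).getD (var 0 rfl)).ite ((var 1 rfl).cons true) nil)
    (.const 1) fun a i l => by split_ifs <;> simp).congr fun a => ?_
  -- The word is scanned from its end: the accumulator counts the ones that open the current suffix,
  -- and a zero resets it.
  have key : ∀ n, n ≤ (f a).length → StackProgram.countdown
      (fun i l => if (f a).getD i false then true :: l else []) n
        (nat (((f a).drop n).takeWhile id).length) = nat ((f a).takeWhile id).length := by
    intro n
    induction n with
    | zero => intro _; rfl
    | succ n ih =>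
      intro hn
      rw [StackProgram.countdown, ← ih (by omega),
        List.drop_eq_getElem_cons (show n < (f a).length by omega),
        List.getD_eq_getElem (n := n) _ _ (by omega), List.takeWhile_cons]
      cases h : (f a)[n] <;> simp [nat, List.replicate_succ]
  simpa [nat] using key _ le_rfl

end PolyTime

/-- A language is in PTIME if its characteristic function can be computed in polynomial time by a
program. -/
theorem mem_PTIME {L : Language Bool} {c : List Bool → Bool} (h : ∀ w, c w = true ↔ w ∈ L)
    (hc : PolyTime [id] fun w => [c w]) : L ∈ PawnGames.PTIME := by
  classical
  obtain ⟨p, t, ⟨q, hq⟩, hp⟩ := hc.exists_prog [0] 1 rfl (by simp)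
  -- Clearing the input stack also resets the register to `none`; a halting configuration must have
  -- both.
  obtain ⟨N, hN⟩ := (Prog.seq p (.clear 0)).exists_usesBelow
  have key : ∀ w v o : List Bool, v = w → o = [c w] → Nonempty (Turing.TM2OutputsInTime
      ((Prog.seq p (.clear 0)).machine N) v (some o)
      ((q + (4 * Polynomial.X + 3) : Polynomial ℕ).eval w.length)) := by
    rintro _ w _ rfl rfl
    obtain ⟨s, u, hu, hle⟩ := hp w (update (fun _ => []) 0 w) (by simp)
      (fun k hk => update_of_ne (by omega) _ _) none
    have hex := hu.seq (.clear 0 _ _)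
    rw [show update (update (update (fun _ => []) 0 w) 1 [c w]) 0 [] =
        (update (fun _ => []) 1 [c w] : Store) from ?_] at hex
    · obtain ⟨o⟩ := hex.outputsInTime hN
      have hw := hle.trans (hq w)
      simp only [Context.size, List.map_cons, List.map_nil, List.sum_cons, List.sum_nil, id,
        add_zero] at hw
      refine ⟨⟨o.toEvalsTo, o.steps_le_m.trans ?_⟩⟩
      simp
      omega
    · funext k
      simp only [update_apply]
      split_ifs <;> simp_all
  let M : Turing.TM2ComputableInPolyTime (id : List Bool → List Bool) Computability.encodeBool
      (fun w => decide (w ∈ L)) :=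
    { tm := (Prog.seq p (.clear 0)).machine N
      inputAlphabet := Equiv.refl Bool
      outputAlphabet := Equiv.refl Bool
      time := q + (4 * Polynomial.X + 3)
      outputsFun := fun w => Classical.choice <| key w _ _ (List.map_id w) <| by
        rw [show decide (w ∈ L) = c w by rw [Bool.eq_iff_iff, h, decide_eq_true_iff]]
        rfl }
  exact ⟨M, fun k => inferInstanceAs (Finite Bool)⟩

end StackProgram

namespace PawnGames

/-! ### Reachability games -/

namespace TurnBasedGame

variable {V : Type} (G : TurnBasedGame V)

/-- The vertices from which Player 1 can force a visit to the target in fewer than `k` moves. -/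
def stage : ℕ → Set V
  | 0 => ∅
  | k + 1 => {v | v ∈ G.target ∨
      (G.owner v = .one ∧ ∃ u, G.edge v u ∧ u ∈ stage k) ∨
      (G.owner v = .two ∧ (∃ u, G.edge v u) ∧ ∀ u, G.edge v u → u ∈ stage k)}

theorem stage_subset_succ (k : ℕ) : G.stage k ⊆ G.stage (k + 1) := by
  induction k with
  | zero => exact Set.empty_subset _
  | succ k ih =>
    rintro v (h | ⟨h, u, hu, hk⟩ | ⟨h, hu, hk⟩)
    · exact Or.inl h
    · exact Or.inr (Or.inl ⟨h, u, hu, ih hk⟩)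
    · exact Or.inr (Or.inr ⟨h, hu, fun u hu => ih (hk u hu)⟩)

theorem stage_mono : Monotone G.stage := monotone_nat_of_le_succ G.stage_subset_succ

theorem play_succ (f₁ f₂ : V → V) (v : V) (k : ℕ) :
    G.play f₁ f₂ v (k + 1) = (G.next f₁ f₂ v).bind fun u => G.play f₁ f₂ u k := by
  induction k with
  | zero =>
    change (some v).bind _ = _
    cases h : G.next f₁ f₂ v <;> simp [play, h]
  | succ k ih =>
    change (G.play f₁ f₂ v (k + 1)).bind _ = _
    rw [ih]
    cases G.next f₁ f₂ v <;> rfl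

theorem next_of_owner_one {f₁ f₂ : V → V} {v : V} (h : ∃ u, G.edge v u) (ho : G.owner v = .one) :
    G.next f₁ f₂ v = some (f₁ v) := by
  simp [next, h, ho]

theorem next_of_owner_two {f₁ f₂ : V → V} {v : V} (h : ∃ u, G.edge v u) (ho : G.owner v = .two) :
    G.next f₁ f₂ v = some (f₂ v) := by
  simp [next, h, ho]

/-- A single memoryless strategy serves all vertices: move to a neighbour of least rank. If some
neighbour lies in `stage k`, then so does the chosen one. -/
theorem playerOneWins_of_mem_stage {k : ℕ} {v : V} (hv : v ∈ G.stage k) : G.PlayerOneWins v := by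
  have hex : ∀ v, (∃ u, G.edge v u) → ∃ u, G.edge v u ∧
      ∀ k, (∃ u, G.edge v u ∧ u ∈ G.stage k) → u ∈ G.stage k := by
    classical
    intro v hv
    by_cases h : ∃ k, ∃ u, G.edge v u ∧ u ∈ G.stage k
    · obtain ⟨u, hu, hk⟩ := Nat.find_spec h
      exact ⟨u, hu, fun k h' => G.stage_mono (Nat.find_min' h h') hk⟩
    · obtain ⟨u, hu⟩ := hv
      exact ⟨u, hu, fun k h' => (h ⟨k, h'⟩).elim⟩
  choose! f₁ hf₁ hs using hex
  refine ⟨f₁, fun v _ h => hf₁ v h, fun f₂ hf₂ => ?_⟩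
  induction k generalizing v with
  | zero => exact hv.elim
  | succ k ih =>
    rcases hv with h | ⟨ho, u, hu, hk⟩ | ⟨ho, hu, hk⟩
    · exact ⟨0, v, h, rfl⟩
    · obtain ⟨i, t, ht, hi⟩ := ih (hs v ⟨u, hu⟩ k ⟨u, hu, hk⟩)
      exact ⟨i + 1, t, ht, by rw [play_succ, G.next_of_owner_one ⟨u, hu⟩ ho]; exact hi⟩
    · obtain ⟨i, t, ht, hi⟩ := ih (hk _ (hf₂ v ho hu))
      exact ⟨i + 1, t, ht, by rw [play_succ, G.next_of_owner_two hu ho]; exact hi⟩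

/-- Outside all stages Player 2 has a trap: Player 1 cannot leave it, and Player 2 need not. -/
theorem playerOneWins_iff [Finite V] (v : V) : G.PlayerOneWins v ↔ ∃ k, v ∈ G.stage k := by
  refine ⟨fun ⟨f₁, hf₁, hwin⟩ => ?_, fun ⟨k, hk⟩ => G.playerOneWins_of_mem_stage hk⟩
  by_contra hv
  have hex : ∀ v, (∃ u, G.edge v u) → ∃ u, G.edge v u ∧
      (G.owner v = .two → (¬∃ k, v ∈ G.stage k) → ¬∃ k, u ∈ G.stage k) := by
    intro v ⟨u, hu⟩
    by_cases h : ∃ u, G.edge v u ∧ ¬∃ k, u ∈ G.stage k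
    · obtain ⟨u, hu, hk⟩ := h
      exact ⟨u, hu, fun _ _ => hk⟩
    · refine ⟨u, hu, fun ho hv => (hv ?_).elim⟩
      push Not at h
      choose! r hr using h
      -- By finiteness the ranks of the neighbours have a common bound, so `v` would lie in a stage
      -- itself.
      obtain ⟨K, hK⟩ := (Set.finite_range r).bddAbove
      exact ⟨K + 1, Or.inr (Or.inr ⟨ho, ⟨u, hu⟩, fun u hu =>
        G.stage_mono (hK ⟨u, rfl⟩) (hr u hu)⟩)⟩
  choose! f₂ hf₂ hs using hex
  obtain ⟨i, t, ht, hi⟩ := hwin f₂ fun v _ h => hf₂ v h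
  have key : ∀ i x, G.play f₁ f₂ v i = some x → ¬∃ k, x ∈ G.stage k := by
    intro i
    induction i with
    | zero =>
      rintro x hx
      cases hx
      exact hv
    | succ i ih =>
      intro x hx
      obtain ⟨y, hy, hyx⟩ := Option.bind_eq_some_iff.1 hx
      have hy' := ih y hy
      by_cases he : ∃ u, G.edge y u
      · cases ho : G.owner y with
        | one =>
          rw [G.next_of_owner_one he ho] at hyx
          cases hyx
          rintro ⟨k, hk⟩
          exact hy' ⟨k + 1, Or.inr (Or.inl ⟨ho, _, hf₁ y ho he, hk⟩)⟩
        | two =>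
          rw [G.next_of_owner_two he ho] at hyx
          cases hyx
          exact hs y he ho hy'
      · simp [next, he] at hyx
  exact key i t hi ⟨1, Or.inl ht⟩

end TurnBasedGame

theorem Player.eq_iff_eq_one_iff {p q : Player} : p = q ↔ (p = .one ↔ q = .one) := by
  cases p <;> cases q <;> simp

theorem Player.opponent_eq_one_iff {p : Player} : p.opponent = .one ↔ ¬p = .one := by
  cases p <;> simp [Player.opponent]

instance {n d : ℕ} : Finite (Config n d) :=
  Finite.of_injective (fun c : Config n d => (c.vertex, c.pawns)) fun c c' h => by
    cases c; cases c'; simpa using h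

/-! ### Always grabbing or giving -/

namespace PawnGame

variable {n d : ℕ} {G : PawnGame n d}

theorem mover_eq_one_iff {c : Config n d} :
    G.mover c = .one ↔ ∃ j ∈ c.pawns, c.vertex ∈ G.owned j := by
  unfold mover
  split_ifs with h <;> simp [h]

/-- Uniqueness of the owner enters the analysis of the game here: control of a vertex hangs on one
pawn. -/
theorem mover_eq_one_iff_of_owned (h : G.IsMVPP) {v : Fin n} {j : Fin d} (hj : v ∈ G.owned j)
    (P : Finset (Fin d)) : G.mover ⟨v, P⟩ = .one ↔ j ∈ P := by
  rw [mover_eq_one_iff]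
  refine ⟨fun ⟨i, hi, hv⟩ => ?_, fun hP => ⟨j, hP, hj⟩⟩
  obtain rfl := (h v).unique hj hv
  exact hi

theorem alwaysGrabOrGive_edge_inr {v : Fin n} {c c' : Config n d} :
    G.alwaysGrabOrGive.edge (.inr (v, c)) (.inl c') ↔
      ∃ j, c' = ⟨v, if j ∈ c.pawns then c.pawns.erase j else insert j c.pawns⟩ := by
  change (∃ j ∈ c.pawns, _) ∨ (∃ j, j ∉ c.pawns ∧ _) ↔ _
  constructor
  · rintro (⟨j, hj, h⟩ | ⟨j, hj, h⟩)
    · exact ⟨j, by rwa [if_pos hj]⟩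
    · exact ⟨j, by rwa [if_neg hj]⟩
  · rintro ⟨j, h⟩
    by_cases hj : j ∈ c.pawns
    · exact Or.inl ⟨j, hj, by rwa [if_pos hj] at h⟩
    · exact Or.inr ⟨j, hj, by rwa [if_neg hj] at h⟩

/-- The player who did not move can choose the next mover freely, unless there is only one pawn:
then the players take turns. -/
theorem exists_edge_mover_iff (h : G.IsMVPP) (v : Fin n) (c : Config n d) (m : Player) :
    (∃ c', G.alwaysGrabOrGive.edge (.inr (v, c)) (.inl c') ∧ G.mover c' = m) ↔
      d ≠ 1 ∨ m = (G.mover c).opponent := by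
  obtain ⟨o, ho⟩ := (h v).exists
  -- Transferring `j` changes the side of the owner `o` exactly when `j = o`.
  have hmem : ∀ j, (o ∈ if j ∈ c.pawns then c.pawns.erase j else insert j c.pawns) ↔
      (o ∈ c.pawns ↔ ¬j = o) := by
    intro j
    by_cases hjo : j = o
    · subst hjo
      by_cases hj : j ∈ c.pawns <;> simp [hj]
    · have : o ≠ j := Ne.symm hjo
      by_cases hj : j ∈ c.pawns <;> simp [hj, hjo, this]
  have hmov : ∀ j, G.mover ⟨v, if j ∈ c.pawns then c.pawns.erase j else insert j c.pawns⟩ = m ↔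
      ((o ∈ c.pawns ↔ ¬j = o) ↔ m = .one) := fun j => by
    rw [Player.eq_iff_eq_one_iff, mover_eq_one_iff_of_owned h ho, hmem]
  have hex : (∃ c', G.alwaysGrabOrGive.edge (.inr (v, c)) (.inl c') ∧ G.mover c' = m) ↔
      ∃ j, (o ∈ c.pawns ↔ ¬j = o) ↔ m = .one := by
    simp only [alwaysGrabOrGive_edge_inr, ← hmov]
    exact ⟨fun ⟨c', ⟨j, hj⟩, hm⟩ => ⟨j, hj ▸ hm⟩, fun ⟨j, hj⟩ => ⟨_, ⟨j, rfl⟩, hj⟩⟩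
  rw [hex]
  by_cases hd : d = 1
  · subst hd
    -- The only pawn owns both `c.vertex` and `v`, and it has to change hands.
    have hc : G.mover c = .one ↔ o ∈ c.pawns := by
      obtain ⟨i, hi⟩ := (h c.vertex).exists
      rw [Subsingleton.elim o i]
      exact mover_eq_one_iff_of_owned h hi c.pawns
    have hj : ∀ j : Fin 1, j = o := fun j => Subsingleton.elim _ _
    rw [Player.eq_iff_eq_one_iff (q := (G.mover c).opponent), Player.opponent_eq_one_iff, hc]
    simp only [hj, ne_eq, not_true_eq_false, false_or, exists_const]
    tauto
  · have : Nontrivial (Fin d) := by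
      have := o.pos
      exact Fin.nontrivial_iff_two_le.2 (by omega)
    obtain ⟨i, hi⟩ := exists_ne o
    simp only [ne_eq, hd, not_false_eq_true, true_or, iff_true]
    -- The witness is `o` if control of `v` has to change, and the other pawn `i` if not.
    by_cases hP : o ∈ c.pawns <;> by_cases hm : m = .one
    · exact ⟨i, by simp [hP, hm, hi]⟩
    · exact ⟨o, by simp [hP, hm]⟩
    · exact ⟨o, by simp [hP, hm]⟩
    · exact ⟨i, by simp [hP, hm, hi]⟩

/-! ### The iteration on pairs of a mover and a vertex. -/

/-- The configurations from which Player 1 wins, described by the position of the token and the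
player who moves it. -/
def winners (G : PawnGame n d) : ℕ → Player → Fin n → Prop
  | 0, _, _ => False
  | t + 1, .one, v => v ∈ G.target ∨ ∃ u, (v, u) ∈ G.edges ∧
      (winners G t .two u ∧ (d = 1 ∨ winners G t .one u))
  | t + 1, .two, v => v ∈ G.target ∨ (∃ u, (v, u) ∈ G.edges) ∧ ∀ u, (v, u) ∈ G.edges →
      (winners G t .one u ∨ d ≠ 1 ∧ winners G t .two u)

/-- The predicate `P` is arbitrary so that the lemma yields the existential condition, by negation
the universal one, and with `True` the existence of a move. -/
theorem edge_inl_iff {c : Config n d} {P : Config n d ⊕ Fin n × Config n d → Prop} :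
    (∃ x, G.alwaysGrabOrGive.edge (.inl c) x ∧ P x) ↔
      ∃ u, (c.vertex, u) ∈ G.edges ∧ P (.inr (u, c)) := by
  constructor
  · rintro ⟨c' | ⟨u, c'⟩, he, hP⟩
    · exact he.elim
    · obtain ⟨hu, rfl⟩ : u ∈ G.neighbors c.vertex ∧ c' = c := he
      exact ⟨u, by simpa [neighbors] using hu, hP⟩
  · rintro ⟨u, hu, hP⟩
    exact ⟨.inr (u, c), ⟨by simpa [neighbors] using hu, rfl⟩, hP⟩

/-- A round of `winners` covers two moves of the game, that of the token and the choice of a pawn;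
hence `2 * t`. The opponent of the mover makes the choice. After a move of Player 1 all possible
next movers must be winning for him; after a move of Player 2 one suffices. With `d = 1` the only
possible next mover is the opponent. -/
theorem mem_stage_iff_winners (h : G.IsMVPP) (t : ℕ) (c : Config n d) :
    .inl c ∈ G.alwaysGrabOrGive.stage (2 * t) ↔ G.winners t (G.mover c) c.vertex := by
  induction t generalizing c with
  | zero => exact Iff.rfl
  | succ t ih =>
    have hvertex : ∀ {u : Fin n} {c c' : Config n d},
        G.alwaysGrabOrGive.edge (.inr (u, c)) (.inl c') → c'.vertex = u := fun he => by
      obtain ⟨j, rfl⟩ := alwaysGrabOrGive_edge_inr.1 he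
      rfl
    have hE : ∀ u, (∃ x, G.alwaysGrabOrGive.edge (.inr (u, c)) x ∧
        x ∈ G.alwaysGrabOrGive.stage (2 * t)) ↔
        ∃ m, (d ≠ 1 ∨ m = (G.mover c).opponent) ∧ G.winners t m u := by
      intro u
      constructor
      · rintro ⟨c' | x, he, hs⟩
        · have hw := (ih c').1 hs
          rw [hvertex he] at hw
          exact ⟨_, (exists_edge_mover_iff h u c _).1 ⟨c', he, rfl⟩, hw⟩
        · exact he.elim
      · rintro ⟨m, hm, hw⟩
        obtain ⟨c', he, rfl⟩ := (exists_edge_mover_iff h u c m).2 hm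
        exact ⟨.inl c', he, (ih c').2 (by rwa [hvertex he])⟩
    have hA : ∀ u, (∀ x, G.alwaysGrabOrGive.edge (.inr (u, c)) x →
        x ∈ G.alwaysGrabOrGive.stage (2 * t)) ↔
        ∀ m, (d ≠ 1 ∨ m = (G.mover c).opponent) → G.winners t m u := by
      intro u
      constructor
      · intro H m hm
        obtain ⟨c', he, rfl⟩ := (exists_edge_mover_iff h u c m).2 hm
        have hw := (ih c').1 (H _ he)
        rwa [hvertex he] at hw
      · rintro H (c' | x) he
        · refine (ih c').2 ?_
          rw [hvertex he]
          exact H _ ((exists_edge_mover_iff h u c _).1 ⟨c', he, rfl⟩)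
        · exact he.elim
    -- The choice of a pawn is never stuck: handing the next move to the opponent is always
    -- possible.
    have hne : ∀ u, ∃ x, G.alwaysGrabOrGive.edge (.inr (u, c)) x := fun u => by
      obtain ⟨c', he, -⟩ := (exists_edge_mover_iff h u c _).2 (Or.inr rfl)
      exact ⟨_, he⟩
    have hinr : ∀ u, .inr (u, c) ∈ G.alwaysGrabOrGive.stage (2 * t + 1) ↔
        ((G.mover c = .two ∧ (G.winners t .one u ∨ d ≠ 1 ∧ G.winners t .two u)) ∨
        (G.mover c = .one ∧ (G.winners t .two u ∧ (d = 1 ∨ G.winners t .one u)))) := by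
      intro u
      have h0 : .inr (u, c) ∉ G.alwaysGrabOrGive.target := by
        rintro ⟨c', hc, -⟩
        cases hc
      change _ ∨ ((G.mover c).opponent = .one ∧ _) ∨ ((G.mover c).opponent = .two ∧ _) ↔ _
      rw [hE, hA]
      simp only [h0, hne, false_or, true_and]
      have hall : ∀ Q : Player → Prop, (∀ m, Q m) ↔ Q .one ∧ Q .two := fun Q =>
        ⟨fun H => ⟨H _, H _⟩, fun H m => by cases m; exacts [H.1, H.2]⟩
      have hany : ∀ Q : Player → Prop, (∃ m, Q m) ↔ Q .one ∨ Q .two := fun Q =>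
        ⟨fun ⟨m, hm⟩ => by cases m; exacts [Or.inl hm, Or.inr hm],
          fun H => H.elim (⟨_, ·⟩) (⟨_, ·⟩)⟩
      rw [hall, hany]
      cases G.mover c with
      | one => simp [Player.opponent]; tauto
      | two => simp [Player.opponent]
    have hE' := edge_inl_iff (G := G) (c := c) (P := (· ∈ G.alwaysGrabOrGive.stage (2 * t + 1)))
    have hA' := not_congr (edge_inl_iff (G := G) (c := c)
      (P := (· ∉ G.alwaysGrabOrGive.stage (2 * t + 1))))
    have hne' := edge_inl_iff (G := G) (c := c) (P := fun _ => True)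
    push Not at hA'
    simp only [and_true] at hne'
    have ht : .inl c ∈ G.alwaysGrabOrGive.target ↔ c.vertex ∈ G.target := by
      constructor
      · rintro ⟨c', hc, hT⟩
        cases hc
        exact hT
      · exact fun hT => ⟨c, rfl, hT⟩
    rw [show 2 * (t + 1) = 2 * t + 1 + 1 by ring]
    change .inl c ∈ G.alwaysGrabOrGive.target ∨ (G.mover c = .one ∧ _) ∨
      (G.mover c = .two ∧ _ ∧ _) ↔ _
    rw [ht, hE', hA', hne']
    simp only [hinr]
    cases G.mover c <;> simp [winners]

theorem playerOneWins_iff_exists_winners (h : G.IsMVPP) (c : Config n d) :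
    G.alwaysGrabOrGive.PlayerOneWins (.inl c) ↔ ∃ t, G.winners t (G.mover c) c.vertex := by
  rw [TurnBasedGame.playerOneWins_iff]
  refine ⟨fun ⟨k, hk⟩ => ⟨k, ?_⟩, fun ⟨t, ht⟩ => ⟨2 * t, (mem_stage_iff_winners h t c).2 ht⟩⟩
  exact (mem_stage_iff_winners h k c).1 (G.alwaysGrabOrGive.stage_mono (by omega) hk)

theorem winners_succ_of_winners (t : ℕ) (m : Player) (v : Fin n) (hw : G.winners t m v) :
    G.winners (t + 1) m v := by
  induction t generalizing m v with
  | zero => exact hw.elim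
  | succ t ih =>
    cases m with
    | one =>
      rcases hw with hT | ⟨u, hu, h2, h1⟩
      · exact Or.inl hT
      · exact Or.inr ⟨u, hu, ih _ _ h2, h1.imp_right (ih _ _)⟩
    | two =>
      rcases hw with hT | ⟨he, H⟩
      · exact Or.inl hT
      · exact Or.inr ⟨he, fun u hu => (H u hu).imp (ih _ _) (And.imp_right (ih _ _))⟩

theorem winners_succ_congr {s t : ℕ} (h : ∀ m v, G.winners s m v ↔ G.winners t m v) (m : Player)
    (v : Fin n) : G.winners (s + 1) m v ↔ G.winners (t + 1) m v := by
  cases m <;> simp only [winners, h]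

/-- The iteration that computes the winning configurations becomes stationary after `2 * n` steps. -/
theorem winners_of_winners {t : ℕ} {m : Player} {v : Fin n} (hw : G.winners t m v) :
    G.winners (2 * n) m v := by
  have hmono : ∀ {s t : ℕ}, s ≤ t → ∀ m v, G.winners s m v → G.winners t m v := by
    intro s t hst m v h
    induction t, hst using Nat.le_induction with
    | base => exact h
    | succ t _ ih => exact winners_succ_of_winners t m v ih
  -- The stages of the iteration as an increasing chain of subsets of a set with `2 * n` elements.
  -- Once two consecutive cardinalities agree, the sets agree, and so do all later ones.
  let f : ℕ → Set (Bool × Fin n) := fun t =>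
    {x | G.winners t (bif x.1 then .one else .two) x.2}
  have hf : Monotone f := fun s t hst x => hmono hst _ _
  have hmem : ∀ s t, f s = f t ↔ ∀ m v, G.winners s m v ↔ G.winners t m v := by
    intro s t
    refine ⟨fun h m v => ?_, fun h => Set.ext fun x => h _ _⟩
    have h1 := Set.ext_iff.1 h (true, v)
    have h2 := Set.ext_iff.1 h (false, v)
    cases m
    exacts [h1, h2]
  have heq : ∀ {s t}, s ≤ t → (f s).ncard = (f t).ncard → f s = f t := fun hst h =>
    Set.eq_of_subset_of_ncard_le (hf hst) h.ge (Set.toFinite _)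
  have hstab := Nat.stabilises_of_monotone (f := fun t => (f t).ncard) (b := 2 * n)
    (n := max t (2 * n)) (fun s t hst => Set.ncard_le_ncard (hf hst) (Set.toFinite _))
    (fun s => by simpa using Set.ncard_le_card (f s))
    (fun s h => congrArg Set.ncard ((hmem _ _).2 fun m v =>
      winners_succ_congr ((hmem _ _).1 (heq (Nat.le_succ s) h)) m v)) (le_max_right _ _)
  exact ((hmem _ _).1 (heq (le_max_right _ _) hstab.symm) m v).2 (hmono (le_max_left _ _) m v hw)

end PawnGame

open StackProgram

/-! ### The algorithm -/

/-- The number of leading ones of a word. -/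
def leadingOnes (w : List Bool) : ℕ := (w.takeWhile id).length

/-- The rest of a word after a block `1…10`. -/
def skipBlock (w : List Bool) : List Bool := w.drop (leadingOnes w + 1)

/-- The bit for "pawn `j` owns vertex `v`" in the encoding of a game with `n` vertices. -/
def ownedBit (n : ℕ) (r : List Bool) (j v : ℕ) : Bool := r.getD (j * n + v) false

/-- The bit for the edge from `v` to `u` in the encoding of a game with `n` vertices and `d`
pawns. -/
def edgeBit (n d : ℕ) (r : List Bool) (v u : ℕ) : Bool := r.getD (d * n + (v * n + u)) false

/-- The bit for "`v` is a target". -/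
def targetBit (n d : ℕ) (r : List Bool) (v : ℕ) : Bool := r.getD (d * n + (n * n + v)) false

/-- The bit for "Player 1 controls pawn `j`". -/
def heldBit (n d : ℕ) (r : List Bool) (j : ℕ) : Bool := r.getD (d * n + (n * n + (n + j))) false

/-- One step of the iteration that computes the winning configurations; `W v` and `W (n + v)` tell
whether Player 1 is known to win when the token is at `v` and Player 1 or Player 2, respectively, is
to move. -/
def winStep (n d : ℕ) (r : List Bool) (W : ℕ → Bool) (s : ℕ) : Bool :=
  bif decide (s < n) then
    targetBit n d r s ||
      (List.range n).any fun u => edgeBit n d r s u && (W (n + u) && (d == 1 || W u))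
  else
    targetBit n d r (s - n) ||
      ((List.range n).any (fun u => edgeBit n d r (s - n) u) &&
        (List.range n).all fun u => !edgeBit n d r (s - n) u || (W u || (!(d == 1) && W (n + u))))

/-- The list of the bits `W s` for `s < 2 * n` after `t` steps of the iteration. -/
def winList (n d : ℕ) (r : List Bool) (t : ℕ) : List Bool :=
  countdown (fun _ R => (List.range (n + n)).map (winStep n d r fun s => R.getD s false)) t []

/-- Each vertex is owned by exactly one pawn. -/
def mvppTest (n d : ℕ) (r : List Bool) : Bool :=
  (List.range n).all fun v => (List.range d).any (fun j => ownedBit n r j v) &&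
    (List.range d).all fun j => (List.range j).all fun i => !(ownedBit n r j v && ownedBit n r i v)

/-- Player 1 wins if the token is at `v`. -/
def winTest (n d : ℕ) (r : List Bool) (v : ℕ) : Bool :=
  bif (List.range d).any (fun j => heldBit n d r j && ownedBit n r j v) then
    (winList n d r (n + n)).getD v false
  else (winList n d r (n + n)).getD (n + v) false

/-- The decision procedure, applied to the four parts of the input. -/
def acceptParts (n d v : ℕ) (r : List Bool) : Bool :=
  decide (v < n) && (r.length == d * n + (n * n + (n + d)) && (mvppTest n d r && winTest n d r v))

/-- The decision procedure. -/
def accept (w : List Bool) : Bool :=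
  decide (leadingOnes w < w.length) &&
  (decide (leadingOnes (skipBlock w) < (skipBlock w).length) &&
  (decide (leadingOnes (skipBlock (skipBlock w)) < (skipBlock (skipBlock w)).length) &&
  acceptParts (leadingOnes w) (leadingOnes (skipBlock w)) (leadingOnes (skipBlock (skipBlock w)))
    (skipBlock (skipBlock (skipBlock w)))))

/-! #### Running time -/

section PolyTime

open PolyTime

variable {α : Type} {xs : Context α} {n d s v u j : α → ℕ} {r R : α → List Bool}

theorem polyTime_lift {f : α → List Bool} (hf : PolyTime xs f) :
    PolyTime ((fun p : α × ℕ => nat p.2) :: xs.map fun x => x ∘ Prod.fst) fun p => f p.1 :=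
  hf.lift (List.subset_cons_self _ _)

theorem polyTime_index :
    PolyTime ((fun p : α × ℕ => nat p.2) :: xs.map fun x => x ∘ Prod.fst) fun p => nat p.2 :=
  var 0 rfl

theorem polyTime_skipBlock (hr : PolyTime xs r) : PolyTime xs fun a => skipBlock (r a) :=
  hr.drop hr.leadingOnes.succ

variable (hn : PolyTime xs fun a => nat (n a)) (hd : PolyTime xs fun a => nat (d a))
  (hr : PolyTime xs r)

include hn hr in
theorem polyTime_ownedBit (hj : PolyTime xs fun a => nat (j a)) (hv : PolyTime xs fun a => nat (v a)) :
    PolyTime xs fun a => [ownedBit (n a) (r a) (j a) (v a)] :=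
  hr.getD ((hj.mul hn).add hv)

include hn hd hr

theorem polyTime_edgeBit (hv : PolyTime xs fun a => nat (v a)) (hu : PolyTime xs fun a => nat (u a)) :
    PolyTime xs fun a => [edgeBit (n a) (d a) (r a) (v a) (u a)] :=
  hr.getD ((hd.mul hn).add ((hv.mul hn).add hu))

theorem polyTime_targetBit (hv : PolyTime xs fun a => nat (v a)) :
    PolyTime xs fun a => [targetBit (n a) (d a) (r a) (v a)] :=
  hr.getD ((hd.mul hn).add ((hn.mul hn).add hv))

theorem polyTime_heldBit (hj : PolyTime xs fun a => nat (j a)) :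
    PolyTime xs fun a => [heldBit (n a) (d a) (r a) (j a)] :=
  hr.getD ((hd.mul hn).add ((hn.mul hn).add (hn.add hj)))

theorem polyTime_winStep (hR : PolyTime xs R) (hs : PolyTime xs fun a => nat (s a)) :
    PolyTime xs fun a => [winStep (n a) (d a) (r a) (fun i => (R a).getD i false) (s a)] := by
  -- `[true]` is `nat 1`.
  have hone : PolyTime xs fun a => [d a == 1] := hd.beq (const [true])
  have hn' := polyTime_lift hn
  have hd' := polyTime_lift hd
  have hr' := polyTime_lift hr
  have hone' := polyTime_lift hone
  have hs' := polyTime_lift hs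
  have hsn' := polyTime_lift (hs.sub hn)
  have hu := polyTime_index (xs := xs)
  have hA := (polyTime_lift hR).getD hu
  have hB := (polyTime_lift hR).getD (hn'.add hu)
  exact (hs.lt hn).cond
    ((polyTime_targetBit hn hd hr hs).or (hn.any
      ((polyTime_edgeBit hn' hd' hr' hs' hu).and (hB.and (hone'.or hA)))))
    ((polyTime_targetBit hn hd hr (hs.sub hn)).or ((hn.any (polyTime_edgeBit hn' hd' hr' hsn' hu)).and
      (hn.all ((polyTime_edgeBit hn' hd' hr' hsn' hu).not.or (hA.or (hone'.not.and hB))))))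

theorem polyTime_winList {t : α → ℕ} (ht : PolyTime xs fun a => nat (t a)) :
    PolyTime xs fun a => winList (n a) (d a) (r a) (t a) := by
  have hl : ∀ {f : α → List Bool}, PolyTime xs f →
      PolyTime ((fun p => nat p.2.1) :: (fun p => p.2.2) :: xs.map fun x => x ∘ Prod.fst)
        fun p : α × ℕ × List Bool => f p.1 := fun hf =>
    hf.lift fun x hx => List.mem_cons_of_mem _ (List.mem_cons_of_mem _ hx)
  have hn' := polyTime_lift (hl hn)
  have hd' := polyTime_lift (hl hd)
  have hr' := polyTime_lift (hl hr)
  have hR : PolyTime ((fun p => nat p.2.1) :: (fun p => p.2.2) :: xs.map fun x => x ∘ Prod.fst)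
      fun p : α × ℕ × List Bool => p.2.2 := var 1 rfl
  exact PolyTime.countdown
    (h := fun a _ R => (List.range (n a + n a)).map
      (winStep (n a) (d a) (r a) fun s => R.getD s false))
    -- Each round produces a list of length `n a + n a`, whatever the previous list was.
    (Q := fun a => n a + n a) ht nil
    (map_range ((hl hn).add (hl hn))
      (polyTime_winStep hn' hd' hr' (polyTime_lift hR) polyTime_index))
    ((hn.add hn).length.mono fun a => by simp) fun a i l => by simp

theorem polyTime_mvppTest : PolyTime xs fun a => [mvppTest (n a) (d a) (r a)] := by
  have hn1 := polyTime_lift hn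
  have hr1 := polyTime_lift hr
  have hd1 := polyTime_lift hd
  have hv1 := polyTime_index (xs := xs)
  have hn2 := polyTime_lift hn1
  have hr2 := polyTime_lift hr1
  have hv2 := polyTime_lift hv1
  have hj2 := polyTime_index (xs := (fun p : α × ℕ => nat p.2) :: xs.map fun x => x ∘ Prod.fst)
  have hn3 := polyTime_lift hn2
  have hr3 := polyTime_lift hr2
  have hv3 := polyTime_lift hv2
  have hj3 := polyTime_lift hj2
  exact hn.all ((hd1.any (polyTime_ownedBit hn2 hr2 hj2 hv2)).and (hd1.all (hj2.all
    ((polyTime_ownedBit hn3 hr3 hj3 hv3).and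
      (polyTime_ownedBit hn3 hr3 polyTime_index hv3)).not)))

theorem polyTime_winTest (hv : PolyTime xs fun a => nat (v a)) :
    PolyTime xs fun a => [winTest (n a) (d a) (r a) (v a)] := by
  have hn' := polyTime_lift hn
  have hd' := polyTime_lift hd
  have hr' := polyTime_lift hr
  have hv' := polyTime_lift hv
  have hR := polyTime_winList hn hd hr (hn.add hn)
  exact PolyTime.cond (hd.any ((polyTime_heldBit hn' hd' hr' polyTime_index).and
    (polyTime_ownedBit hn' hr' polyTime_index hv'))) (hR.getD hv) (hR.getD (hn.add hv))

theorem polyTime_acceptParts (hv : PolyTime xs fun a => nat (v a)) :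
    PolyTime xs fun a => [acceptParts (n a) (d a) (v a) (r a)] :=
  (hv.lt hn).and ((hr.length_nat.beq ((hd.mul hn).add ((hn.mul hn).add (hn.add hd)))).and
    ((polyTime_mvppTest hn hd hr).and (polyTime_winTest hn hd hr hv)))

end PolyTime

theorem polyTime_accept : PolyTime [id] fun w => [accept w] := by
  have h0 : PolyTime [id] fun w : List Bool => w := .var 0 rfl
  have h1 := polyTime_skipBlock h0
  have h2 := polyTime_skipBlock h1
  exact (h0.leadingOnes.lt h0.length_nat).and ((h1.leadingOnes.lt h1.length_nat).and
    ((h2.leadingOnes.lt h2.length_nat).and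
      (polyTime_acceptParts h0.leadingOnes h1.leadingOnes (polyTime_skipBlock h2) h2.leadingOnes)))

/-! #### Correctness -/

/-- The inequality says that a zero ends the run of leading ones; the block and the rest are then
determined by `w`. -/
theorem eq_unary_append_iff {w r : List Bool} {k : ℕ} :
    w = unary k ++ r ↔ leadingOnes w < w.length ∧ k = leadingOnes w ∧ r = skipBlock w := by
  have h1 : ∀ (k : ℕ) (r : List Bool), leadingOnes (unary k ++ r) = k := by
    intro k r
    simp [leadingOnes, unary]
  constructor
  · rintro rfl
    rw [skipBlock, h1]
    refine ⟨by simp [unary], rfl, ?_⟩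
    rw [List.drop_left' (by simp [unary])]
  · rintro ⟨h, rfl, rfl⟩
    induction w with
    | nil => simp at h
    | cons b w ih =>
      cases b with
      | false => simp [leadingOnes, skipBlock, unary]
      | true =>
        have := ih (by simpa [leadingOnes] using h)
        simpa [leadingOnes, skipBlock, unary, List.replicate_succ] using this

/-! ### Decoding words into games. -/

/-- The subset of `{0, …, m - 1}` with characteristic function `b`. -/
def decodeSet (m : ℕ) (b : ℕ → Bool) : Finset (Fin m) := Finset.univ.filter fun i => b i

theorem bits_decodeSet {m : ℕ} {l : List Bool} (hl : l.length = m) :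
    bits (decodeSet m fun i => l.getD i false) = l := by
  subst hl
  conv_rhs => rw [← List.ofFn_get l]
  simp [bits, decodeSet]

theorem flatten_bits_decodeSet {k m : ℕ} {l : List Bool} (hl : l.length = k * m) :
    (List.ofFn fun j : Fin k => bits (decodeSet m fun i => l.getD (j * m + i) false)).flatten =
      l := by
  have : l = List.ofFn fun i : Fin (k * m) => l.getD i false := by
    refine List.ext_getElem (by simpa using hl) fun i h _ => ?_
    simp [h]
  conv_rhs => rw [this, List.ofFn_mul]
  simp [bits, decodeSet]

/-- The list of the bits of a game and of the set of pawns of Player 1. -/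
def gameBits {n d : ℕ} (owned : Fin d → Finset (Fin n)) (nbrs : Fin n → Finset (Fin n))
    (target : Finset (Fin n)) (pawns : Finset (Fin d)) : List Bool :=
  (List.ofFn fun j => bits (owned j)).flatten ++ ((List.ofFn fun v => bits (nbrs v)).flatten ++
    (bits target ++ bits pawns))

theorem encode_eq {n d : ℕ} (G : PawnGame n d) (c : Config n d) :
    encode G c = unary n ++ (unary d ++ (unary c.vertex ++
      gameBits G.owned G.neighbors G.target c.pawns)) := by
  simp [encode, gameBits]

theorem length_flatten_bits {k m : ℕ} (F : Fin k → Finset (Fin m)) :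
    (List.ofFn fun j => bits (F j)).flatten.length = k * m := by
  simp [List.length_flatten, List.map_ofFn, bits, Function.comp_def]

theorem length_gameBits {n d : ℕ} (owned : Fin d → Finset (Fin n))
    (nbrs : Fin n → Finset (Fin n)) (target : Finset (Fin n)) (pawns : Finset (Fin d)) :
    (gameBits owned nbrs target pawns).length = d * n + (n * n + (n + d)) := by
  simp only [gameBits, List.length_append, length_flatten_bits]
  simp [bits]

/-- Every word of the right length is the bit list of some sets, so the procedure need only check
the length. -/
theorem gameBits_decodeSet {n d : ℕ} {r : List Bool}
    (hr : r.length = d * n + (n * n + (n + d))) :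
    gameBits (fun j : Fin d => decodeSet n (ownedBit n r j))
      (fun v : Fin n => decodeSet n (edgeBit n d r v)) (decodeSet n (targetBit n d r))
      (decodeSet d (heldBit n d r)) = r := by
  obtain ⟨r1, r', rfl, h1⟩ : ∃ a b, r = a ++ b ∧ a.length = d * n :=
    ⟨_, _, (List.take_append_drop (d * n) r).symm, by simp; omega⟩
  obtain ⟨r2, r'', rfl, h2⟩ : ∃ a b, r' = a ++ b ∧ a.length = n * n :=
    ⟨_, _, (List.take_append_drop (n * n) r').symm, by simp at hr ⊢; omega⟩
  obtain ⟨r3, r4, rfl, h3⟩ : ∃ a b, r'' = a ++ b ∧ a.length = n :=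
    ⟨_, _, (List.take_append_drop n r'').symm, by simp at hr ⊢; omega⟩
  have h4 : r4.length = d := by simp at hr; omega
  have e1 : ∀ j : Fin d, decodeSet n (ownedBit n (r1 ++ (r2 ++ (r3 ++ r4))) j) =
      decodeSet n fun i => r1.getD (j * n + i) false := by
    intro j
    refine Finset.filter_congr fun i _ => ?_
    have : (j : ℕ) * n + i < d * n := by nlinarith [j.2, i.2]
    rw [ownedBit, List.getD_append _ _ _ _ (by omega)]
  have e2 : ∀ j : Fin n, decodeSet n (edgeBit n d (r1 ++ (r2 ++ (r3 ++ r4))) j) =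
      decodeSet n fun i => r2.getD (j * n + i) false := by
    intro j
    refine Finset.filter_congr fun i _ => ?_
    have : (j : ℕ) * n + i < n * n := by nlinarith [j.2, i.2]
    rw [edgeBit, List.getD_append_right _ _ _ _ (by omega), h1, Nat.add_sub_cancel_left,
      List.getD_append _ _ _ _ (by omega)]
  have e3 : decodeSet n (targetBit n d (r1 ++ (r2 ++ (r3 ++ r4)))) =
      decodeSet n fun i => r3.getD i false := by
    refine Finset.filter_congr fun i _ => ?_
    rw [targetBit, List.getD_append_right _ _ _ _ (by omega), h1, Nat.add_sub_cancel_left,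
      List.getD_append_right _ _ _ _ (by omega), h2, Nat.add_sub_cancel_left,
      List.getD_append _ _ _ _ (by omega)]
  have e4 : decodeSet d (heldBit n d (r1 ++ (r2 ++ (r3 ++ r4)))) =
      decodeSet d fun i => r4.getD i false := by
    refine Finset.filter_congr fun i _ => ?_
    rw [heldBit, List.getD_append_right _ _ _ _ (by omega), h1, Nat.add_sub_cancel_left,
      List.getD_append_right _ _ _ _ (by omega), h2, Nat.add_sub_cancel_left,
      List.getD_append_right _ _ _ _ (by omega), h3, Nat.add_sub_cancel_left]
  simp only [gameBits, e1, e2, e3, e4]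
  rw [flatten_bits_decodeSet h1, flatten_bits_decodeSet h2, bits_decodeSet h3, bits_decodeSet h4]

theorem gameBits_injective {n d : ℕ} {o o' : Fin d → Finset (Fin n)} {e e' : Fin n → Finset (Fin n)}
    {t t' : Finset (Fin n)} {p p' : Finset (Fin d)} (h : gameBits o e t p = gameBits o' e' t' p') :
    o = o' ∧ e = e' ∧ t = t' ∧ p = p' := by
  obtain ⟨h1, h⟩ := bits_rows_injective h
  obtain ⟨h2, h⟩ := bits_rows_injective h
  obtain ⟨h3, h4⟩ := List.append_inj h (by simp [bits])
  exact ⟨h1, h2, bits_injective h3, bits_injective h4⟩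

/-- The word `r` holds the bits of the game `G` and of the set `P` of pawns. -/
structure Represents {n d : ℕ} (r : List Bool) (G : PawnGame n d) (P : Finset (Fin d)) : Prop where
  owned (j : Fin d) (v : Fin n) : ownedBit n r j v = true ↔ v ∈ G.owned j
  edge (v u : Fin n) : edgeBit n d r v u = true ↔ (v, u) ∈ G.edges
  target (v : Fin n) : targetBit n d r v = true ↔ v ∈ G.target
  held (j : Fin d) : heldBit n d r j = true ↔ j ∈ P

/-- Decoding the word and encoding the result gives the word back, so by injectivity the decoded
sets are the original ones. No index computation is needed. -/
theorem represents_gameBits {n d : ℕ} (G : PawnGame n d) (P : Finset (Fin d)) :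
    Represents (gameBits G.owned G.neighbors G.target P) G P := by
  obtain ⟨h1, h2, h3, h4⟩ := gameBits_injective
    (gameBits_decodeSet (length_gameBits G.owned G.neighbors G.target P))
  generalize gameBits G.owned G.neighbors G.target P = r at h1 h2 h3 h4
  refine ⟨fun j v => ?_, fun v u => ?_, fun v => ?_, fun j => ?_⟩
  · rw [← h1]; simp [decodeSet]
  · have : (v, u) ∈ G.edges ↔ u ∈ G.neighbors v := by simp [PawnGame.neighbors]
    rw [this, ← h2]; simp [decodeSet]
  · rw [← h3]; simp [decodeSet]
  · rw [← h4]; simp [decodeSet]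

theorem any_range_iff {m : ℕ} {b : ℕ → Bool} :
    (List.range m).any b = true ↔ ∃ i : Fin m, b i = true := by
  simp only [List.any_eq_true, List.mem_range]
  exact ⟨fun ⟨i, h, hb⟩ => ⟨⟨i, h⟩, hb⟩, fun ⟨i, hb⟩ => ⟨i, i.2, hb⟩⟩

theorem all_range_iff {m : ℕ} {b : ℕ → Bool} :
    (List.range m).all b = true ↔ ∀ i : Fin m, b i = true := by
  simp only [List.all_eq_true, List.mem_range]
  exact ⟨fun h i => h i i.2, fun h i hi => h ⟨i, hi⟩⟩

/-- Stated for a bare family of sets, because `acceptParts_iff` needs the result to prove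
`owned_cover` before there is a game. -/
theorem mvppTest_iff_of {n d : ℕ} {r : List Bool} {o : Fin d → Finset (Fin n)}
    (h : ∀ (j : Fin d) (v : Fin n), ownedBit n r j v = true ↔ v ∈ o j) :
    mvppTest n d r = true ↔ ∀ v, ∃! j, v ∈ o j := by
  simp only [mvppTest, all_range_iff, Bool.and_eq_true, any_range_iff, h, Bool.not_eq_true']
  refine forall_congr' fun v => ?_
  constructor
  · rintro ⟨⟨j, hj⟩, hu⟩
    have key : ∀ i j : Fin d, v ∈ o i → v ∈ o j → ¬i < j := by
      intro i j hi hj hij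
      have := hu j ⟨i, hij⟩
      rw [(h j v).2 hj, (h i v).2 hi] at this
      simp at this
    exact ⟨j, hj, fun i hi => le_antisymm (not_lt.1 (key _ _ hj hi)) (not_lt.1 (key _ _ hi hj))⟩
  · rintro ⟨j, hj, hu⟩
    refine ⟨⟨j, hj⟩, fun i k => ?_⟩
    by_contra hc
    simp only [Bool.not_eq_false, Bool.and_eq_true] at hc
    have hk := (h ⟨k, k.2.trans i.2⟩ v).1 hc.2
    have := hu i ((h i v).1 hc.1)
    have := hu _ hk
    have hki : (⟨k, k.2.trans i.2⟩ : Fin d) = i := by simp_all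
    exact k.2.ne (Fin.ext_iff.1 hki)

theorem getD_winList_succ (n d : ℕ) (r : List Bool) (t s : ℕ) :
    (winList n d r (t + 1)).getD s false =
      (decide (s < n + n) && winStep n d r (fun i => (winList n d r t).getD i false) s) := by
  -- `countdown` unfolds its first round; as the step ignores the index, the last round can be split
  -- off instead.
  have key : ∀ (F : List Bool → List Bool) (t : ℕ) (z : List Bool),
      countdown (fun _ => F) (t + 1) z = F (countdown (fun _ => F) t z) := by
    intro F t
    induction t with
    | zero => intro z; rfl
    | succ t ih => intro z; rw [countdown, ih]; rfl
  rw [winList, key]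
  by_cases hs : s < n + n
  · rw [List.getD_eq_getElem _ _ (by simpa using hs)]
    simp [hs, winList]
  · rw [List.getD_eq_default _ _ (by simpa using hs)]
    simp [hs]

namespace Represents

variable {n d : ℕ} {r : List Bool} {G : PawnGame n d} {P : Finset (Fin d)}

theorem getD_winList_iff (h : Represents r G P) (t : ℕ) (v : Fin n) :
    ((winList n d r t).getD v false = true ↔ G.winners t .one v) ∧
      ((winList n d r t).getD (n + v) false = true ↔ G.winners t .two v) := by
  induction t generalizing v with
  | zero => simp [winList, countdown, PawnGame.winners]
  | succ t ih =>
    have hv : (v : ℕ) < n + n := v.2.trans_le (Nat.le_add_right n n)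
    have hv' : ¬n + (v : ℕ) < n := by omega
    constructor
    · rw [getD_winList_succ, winStep]
      simp only [hv, v.2, decide_true, Bool.true_and, cond_true, Bool.or_eq_true, h.target,
        any_range_iff, Bool.and_eq_true, h.edge, (ih _).1, (ih _).2, beq_iff_eq]
      rfl
    · rw [getD_winList_succ, winStep]
      simp only [Nat.add_lt_add_iff_left, v.2, hv', decide_true, decide_false, Bool.true_and,
        cond_false, Nat.add_sub_cancel_left, Bool.or_eq_true, h.target, any_range_iff,
        all_range_iff, Bool.and_eq_true, h.edge, (ih _).1, (ih _).2, Bool.not_eq_true',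
        beq_eq_false_iff_ne]
      refine or_congr_right (and_congr_right fun _ => forall_congr' fun u => ?_)
      rw [← h.edge, ← Bool.not_eq_true, imp_iff_not_or]

theorem winTest_iff (h : Represents r G P) (hG : G.IsMVPP) (v : Fin n) :
    winTest n d r v = true ↔ G.alwaysGrabOrGive.PlayerOneWins (.inl ⟨v, P⟩) := by
  rw [PawnGame.playerOneWins_iff_exists_winners hG]
  -- Running `n + n` rounds suffices, since the iteration is stationary from then on.
  have hex : ∀ m, (∃ t, G.winners t m v) ↔ G.winners (n + n) m v := fun m =>
    ⟨fun ⟨t, ht⟩ => two_mul n ▸ PawnGame.winners_of_winners ht, fun ht => ⟨_, ht⟩⟩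
  have hm : (List.range d).any (fun j => heldBit n d r j && ownedBit n r j v) = true ↔
      G.mover ⟨v, P⟩ = .one := by
    simp only [any_range_iff, Bool.and_eq_true, h.held, h.owned, PawnGame.mover_eq_one_iff]
  rw [winTest, hex]
  cases hb : (List.range d).any (fun j => heldBit n d r j && ownedBit n r j v) with
  | true => rw [hm.1 hb]; exact (h.getD_winList_iff _ v).1
  | false =>
    have : G.mover ⟨v, P⟩ = .two := by
      cases hc : G.mover ⟨v, P⟩ with
      | one => rw [hm.2 hc] at hb; cases hb
      | two => rfl
    rw [this]
    exact (h.getD_winList_iff _ v).2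

end Represents

theorem acceptParts_iff {n d v : ℕ} {r : List Bool} :
    acceptParts n d v r = true ↔ ∃ (G : PawnGame n d) (c : Config n d), v = c.vertex ∧
      r = gameBits G.owned G.neighbors G.target c.pawns ∧
      G.IsMVPP ∧ G.alwaysGrabOrGive.PlayerOneWins (.inl c) := by
  simp only [acceptParts, Bool.and_eq_true, decide_eq_true_eq, beq_iff_eq]
  constructor
  · rintro ⟨hv, hr, hM, hW⟩
    have hM' := (mvppTest_iff_of (o := fun j : Fin d => decodeSet n (ownedBit n r j))
      (fun j v => by simp [decodeSet])).1 hM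
    let G : PawnGame n d :=
      { owned := fun j => decodeSet n (ownedBit n r j)
        edges := Finset.univ.filter fun e => edgeBit n d r e.1 e.2
        target := decodeSet n (targetBit n d r)
        owned_cover := fun v => (hM' v).exists }
    have hr' : r = gameBits G.owned G.neighbors G.target (decodeSet d (heldBit n d r)) := by
      have hn : G.neighbors = fun v : Fin n => decodeSet n (edgeBit n d r v) := by
        funext v
        ext u
        simp [G, PawnGame.neighbors, decodeSet]
      rw [hn]
      exact (gameBits_decodeSet hr).symm
    have hR : Represents r G (decodeSet d (heldBit n d r)) := by
      have := represents_gameBits G (decodeSet d (heldBit n d r))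
      rwa [← hr'] at this
    exact ⟨G, ⟨⟨v, hv⟩, _⟩, rfl, hr', hM', (hR.winTest_iff hM' ⟨v, hv⟩).1 hW⟩
  · rintro ⟨G, c, rfl, rfl, hM, hW⟩
    have hR := represents_gameBits G c.pawns
    exact ⟨c.vertex.2, length_gameBits _ _ _ _, (mvppTest_iff_of hR.owned).2 hM,
      (hR.winTest_iff hM c.vertex).2 hW⟩

theorem accept_iff (w : List Bool) : accept w = true ↔ w ∈ mvppAlwaysGrabOrGivePawnGames := by
  simp only [accept, Bool.and_eq_true, decide_eq_true_eq, acceptParts_iff]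
  constructor
  · rintro ⟨h0, h1, h2, G, c, hv, hr, hM, hW⟩
    refine ⟨_, _, G, c, ?_, hM, hW⟩
    rw [encode_eq, ← hv, ← hr]
    exact eq_unary_append_iff.2 ⟨h0, rfl, (eq_unary_append_iff.2 ⟨h1, rfl,
      (eq_unary_append_iff.2 ⟨h2, rfl, rfl⟩).symm⟩).symm⟩
  · rintro ⟨n, d, G, c, hw, hM, hW⟩
    rw [encode_eq] at hw
    obtain ⟨h0, rfl, hw⟩ := eq_unary_append_iff.1 hw
    obtain ⟨h1, rfl, hw⟩ := eq_unary_append_iff.1 hw.symm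
    obtain ⟨h2, hv, hr⟩ := eq_unary_append_iff.1 hw.symm
    exact ⟨h0, h1, h2, G, c, hv.symm, hr.symm, hM, hW⟩

end PawnGames

theorem mainTheorem5 :
    PawnGames.mvppAlwaysGrabOrGivePawnGames ∈ PawnGames.PTIME :=
  StackProgram.mem_PTIME PawnGames.accept_iff PawnGames.polyTime_accept
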